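/- **Setting.** Let $\mathbb B=\{0,1\}$. An *offline estimator* is a sequence $(q_s)_{s\ge 0}$ of probability mass functions $q_s:\mathbb B^s\to[0,1]$; it is *deterministic* if every $q_s$ takes only the values $0$ and $1$. An *online estimator* is a function $\tilde q:\mathbb B^*\to[0,1]$ with $\tilde q(\epsilon)=1$ for the empty string $\epsilon$ and $\tilde q(x0)+\tilde q(x1)=\tilde q(x)$ for all $x\in\mathbb B^*$. The regret is $R_n=R_n(\tilde q\|q_n)=\max_{x\in\mathbb B^n}\ln\frac{q_n(x)}{\tilde q(x)}\in(-\infty,\infty]$ (strings with $q_n(x)=0$ do not contribute, and $R_n=\infty$ if $\tilde q(x)=0<q_n(x)$ for some $x$). The machine model is the random access machine (RAM) whose registers hold natural numbers and whose instructions (assignment of a constant, addition, truncated subtraction, indirect load and store, conditional jump) cost one step each. A function $F:\mathbb B^*\to[0,\infty)$ is in $\mathrm{DTIME}(g(n))$ if there is a program which on input $x\in\mathbb B^n$ and any rational $\delta>0$ outputs a rational number $a$ with $|a-F(x)|\le\delta F(x)$ in time $O(g(n))$, where for online estimators the $O$-constant may depend on $\delta$, while the time bounds asserted for offline estimators below are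 uniform in $\delta$. Let $\mathrm P=\bigcup_{k}\mathrm{DTIME}(n^k)$ and $\mathrm E^c=\mathrm{DTIME}(2^{cn})$. An offline estimator $(q_s)$ is identified with the function $x\mapsto q_s(x)$ for $x\in\mathbb B^s$. For a predictor $Q$ (conditional probabilities $Q(b|x)\ge 0$ for $b\in\mathbb B$, $x\in\mathbb B^*$, with $Q(0|x)+Q(1|x)=1$) put $\tilde q^{\mathrm{mix}}(x)=\sum_{s=0}^\infty \frac{\bar q_s(x)}{(s+1)(s+2)}$, where for $x\in\mathbb B^n$, $\bar q_s(x)=\sum_{y\in\mathbb B^{s-n}}q_s(xy)$ if $n\le s$, and $\bar q_s(x)=q_s(x_{1:s})\prod_{t=s+1}^n Q(x_t|x_{1:t-1})$ if $n>s$. **Theorem.** Let $r,c,\varepsilon>0$ be real numbers. (i) If $\varepsilon<1$, there is a deterministic offline estimator $(q_s)\in\mathrm{DTIME}(s^{b+m})$, with $b=\frac{c+1+\varepsilon}{1-\varepsilon}\,r$ and $m=1$, such that every online estimator $\tilde q\in\mathrm E^c$ satisfies $R_n(\tilde q\|q_n)\ge r\ln n$ for all but finitely many $n$. (ii) There is a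 deterministic offline estimator $(q_s)\in\mathrm P$ such that every online estimator $\tilde q\in\mathrm E^c$ satisfies $R_n(\tilde q\|q_n)\ge r\ln n$ for all but finitely many $n$. (iii) There is a deterministic offline estimator $(q_s)\in\mathrm{DTIME}(s^{r+m+\varepsilon})$, with $m=1$, such that every online estimator $\tilde q\in\mathrm P$ satisfies $R_n(\tilde q\|q_n)\ge r\ln n$ for all but finitely many $n$. (iv) There is a deterministic offline estimator $(q_s)\in\mathrm P$ such that $\tilde q^{\mathrm{mix}}\notin\mathrm E^c$ for every choice of the predictor $Q$. -/

import Mathlib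

open Filter Asymptotics

namespace OfflineOnline

/-! ### Random access machines

Registers `R 0, R 1, R 2, …` hold natural numbers; every instruction costs one step. Addition and
(truncated) subtraction are the only arithmetic operations. -/

/-- The instructions of a random access machine. -/
inductive Instr : Type
  /-- `R i := a` -/
  | const (i a : ℕ)
  /-- `R i := R j + R k` -/
  | add (i j k : ℕ)
  /-- `R i := max (R j - R k) 0` -/
  | sub (i j k : ℕ)
  /-- `R i := R (R j)` -/
  | load (i j : ℕ)
  /-- `R (R i) := R j` -/
  | store (i j : ℕ)
  /-- if `0 < R i` then go to line `l`, else continue with the next line -/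
  | jpos (i l : ℕ)

/-- A program is a finite list of instructions, its lines being numbered from `0`. -/
abbrev Program : Type := List Instr

/-- A configuration: the program counter and the contents of all registers. -/
structure Config : Type where
  pc : ℕ
  reg : ℕ → ℕ

/-- The effect of one instruction. -/
def Instr.exec : Instr → Config → Config
  | .const i a, c => ⟨c.pc + 1, Function.update c.reg i a⟩
  | .add i j k, c => ⟨c.pc + 1, Function.update c.reg i (c.reg j + c.reg k)⟩
  | .sub i j k, c => ⟨c.pc + 1, Function.update c.reg i (c.reg j - c.reg k)⟩
  | .load i j, c => ⟨c.pc + 1, Function.update c.reg i (c.reg (c.reg j))⟩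
  | .store i j, c => ⟨c.pc + 1, Function.update c.reg (c.reg i) (c.reg j)⟩
  | .jpos i l, c => ⟨if 0 < c.reg i then l else c.pc + 1, c.reg⟩

/-- The machine has halted when the program counter points outside of the program. -/
def Halted (p : Program) (c : Config) : Prop := p.length ≤ c.pc

/-- One step of the machine; a halted configuration does not change any more. -/
def step (p : Program) (c : Config) : Config :=
  match p[c.pc]? with
  | none => c
  | some i => i.exec c

/-- The initial configuration on the input string `x` and the accuracy `ε`: register `0` holds the
length of `x`, registers `1` and `2` hold numerator and denominator of `ε`, the registers from `3`
on hold the bits of `x`, and all other registers are `0`. -/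
def initial (x : List Bool) (ε : ℚ) : Config where
  pc := 0
  reg
    | 0 => x.length
    | 1 => ε.num.toNat
    | 2 => ε.den
    | i + 3 => (x.getD i false).toNat

/-- On input `x` and `ε`, the program `p` halts after at most `t` steps, and its output, the
rational number `R 0 / R 1`, approximates `v` to relative accuracy `ε`. -/
def Approximates (p : Program) (x : List Bool) (ε : ℚ) (t : ℕ) (v : ℝ) : Prop :=
  Halted p ((step p)^[t] (initial x ε)) ∧
  0 < ((step p)^[t] (initial x ε)).reg 1 ∧
  |(((step p)^[t] (initial x ε)).reg 0 : ℝ) / (((step p)^[t] (initial x ε)).reg 1 : ℝ) - v|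
    ≤ (ε : ℝ) * v

/-! ### Time complexity classes of real-valued functions on binary strings -/

/-- `F ∈ DTIME(g(n))`: some program computes, for every rational `ε > 0` given as an extra
argument, an approximation of `F x` to relative accuracy `ε` in time `O(g(n))`, where `n` is the
length of `x`. -/
def InDTIME (g : ℕ → ℝ) (F : List Bool → ℝ) : Prop :=
  ∃ p : Program, ∀ ε : ℚ, 0 < ε → ∃ T : ℕ → ℕ, (fun n => (T n : ℝ)) =O[atTop] g ∧
    ∀ x : List Bool, Approximates p x ε (T x.length) (F x)

/-- The stronger form of `F ∈ DTIME(g(n))` in which the running time is `O(g(n))` uniformly in the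
accuracy `ε`. -/
def InUniformDTIME (g : ℕ → ℝ) (F : List Bool → ℝ) : Prop :=
  ∃ p : Program, ∃ T : ℕ → ℕ, (fun n => (T n : ℝ)) =O[atTop] g ∧
    ∀ ε : ℚ, 0 < ε → ∀ x : List Bool, Approximates p x ε (T x.length) (F x)

/-- `P`, the union of all `DTIME(n^k)`. -/
def InP (F : List Bool → ℝ) : Prop := ∃ k : ℕ, InDTIME (fun n => (n : ℝ) ^ k) F

/-- `P`, with running times uniform in the accuracy. -/
def InUniformP (F : List Bool → ℝ) : Prop := ∃ k : ℕ, InUniformDTIME (fun n => (n : ℝ) ^ k) F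

/-- `E^c = DTIME(2^(c n))`. -/
def InE (c : ℝ) (F : List Bool → ℝ) : Prop := InDTIME (fun n => (2 : ℝ) ^ (c * (n : ℝ))) F

/-! ### Estimators -/

/-- An offline estimator `(q_s)`: for each `s` the restriction of `q` to the strings of length `s`
is a probability mass function. -/
def IsOffline (q : List Bool → ℝ) : Prop :=
  (∀ x, 0 ≤ q x) ∧ ∀ s : ℕ, ∑ x : Fin s → Bool, q (List.ofFn x) = 1

/-- A deterministic estimator only takes the values `0` and `1`. -/
def IsDeterministic (q : List Bool → ℝ) : Prop := ∀ x, q x = 0 ∨ q x = 1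

/-- An online, i.e. time-consistent, estimator. -/
def IsOnline (q : List Bool → ℝ) : Prop :=
  (∀ x, 0 ≤ q x) ∧ q [] = 1 ∧ ∀ x, q (x ++ [false]) + q (x ++ [true]) = q x

/-- The worst-case log-loss regret `R_n = max_x ln (q_n(x) / q̃(x))` over the strings `x` of length
`n`. It is `⊤` if `q̃ x = 0 < q x` for some `x`; strings with `q x = 0` do not contribute. -/
noncomputable def regret (qt q : List Bool → ℝ) (n : ℕ) : EReal :=
  ⨆ x : Fin n → Bool,
    ENNReal.log (ENNReal.ofReal (q (List.ofFn x)) / ENNReal.ofReal (qt (List.ofFn x)))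

/-- A predictor: `Q x b` is the probability of the symbol `b` given the past `x`. -/
def IsPredictor (Q : List Bool → Bool → ℝ) : Prop :=
  (∀ x b, 0 ≤ Q x b) ∧ ∀ x, Q x false + Q x true = 1

/-- `condProb Q y z` is the probability `Q(z|y)` that the string `z` follows, given the past `y`. -/
def condProb (Q : List Bool → Bool → ℝ) : List Bool → List Bool → ℝ
  | _, [] => 1
  | y, b :: z => Q y b * condProb Q (y ++ [b]) z

/-- The extension `q̄_s` of `q_s` to strings of all lengths: by marginalization to strings of length
at most `s`, and by the conditional probabilities of `Q` to longer ones. -/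
def extension (q : List Bool → ℝ) (Q : List Bool → Bool → ℝ) (s : ℕ) (x : List Bool) : ℝ :=
  if x.length ≤ s then ∑ y : Fin (s - x.length) → Bool, q (x ++ List.ofFn y)
  else q (x.take s) * condProb Q (x.take s) (x.drop s)

/-- The mixture `∑_s w_s q̄_s` with the prior `w_s = 1 / ((s + 1) (s + 2))`. -/
noncomputable def mixture (q : List Bool → ℝ) (Q : List Bool → Bool → ℝ) (x : List Bool) : ℝ :=
  ∑' s : ℕ, extension q Q s x * (1 / (((s : ℝ) + 1) * ((s : ℝ) + 2)))

end OfflineOnline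

/-!
The proof is a diagonalization by counting. Let the input length `s` be given, and let `m` be about
`(log₂ s) / B` for a large constant `B`. Consider the `2 ^ m` programs that are encoded by words of
`m` bits, and the strings of length `l = e + m + 2`, where `e = A * m` and `2 ^ e` is at least
`2 * s ^ r`. Run all these programs for `2 ^ (C * m)` steps, where `C` is a constant, on all these
strings, with the accuracy `1 / 2`. The values of an online estimator on the strings of length `l`
add up to one, so a program that computes an online estimator has an output greater than `2 ^ (-e)`
on at most `2 ^ (e + 1)` of them. If every program excludes the first `2 ^ (e + 1)` strings on
which its output is that large, whatever it computes, then at most `2 ^ m * 2 ^ (e + 1) < 2 ^ l`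
strings are excluded. The deterministic estimator gives probability one to the first string that is
not excluded, followed by zeros. For all large `s` a given online estimator in `E^c` is among the
programs considered and halts in time, so it is at most `2 * 2 ^ (-e) ≤ s ^ (-r)` on the chosen
string (`Sizes.choice_le`), and on its extensions. The search takes time about
`2 ^ l * 2 ^ m * 2 ^ (C * m)`, which is `2 ^ ((A + 2 + C) * m)` up to a constant, and `A / B` and
`C / B` may be chosen close to `r` and `r * c`. This proves `exists_estimator`: every exponent
greater than `r + r * c` (and at least `1`, for reading the input) will do. The first three parts
of the theorem are special cases, as `P` is contained in `E^(1 / r)`. For the last part, the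
mixture is an online estimator that dominates `q_s` with the weight `1 / ((s + 1) * (s + 2))`; so
its regret is less than `3 * log s`, and it does not lie in `E^c` if the estimator is chosen for
`r = 3`.

The bulk of the file shows that a random access machine performs the search within this time. Its
program is written in a small structured language whose compiler is verified with exact step counts
(`Exec.correct`), and reasoned about by weakest preconditions with a clock. The machine simulates
other programs by an interpreter that needs a bounded number of steps for each simulated step
(`wp_step`). As a step at most doubles the values and addresses that occur, a run of `n` steps only
touches a known segment of the memory; every run is given a segment of its own, so no time is spent
on clearing memory (`wp_run`). The search is `Sizes.wp_search`, the complete program is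
`estimator_approximates`, and its running time is estimated in `totalTime_isBigO`.
-/

namespace OfflineOnline

/-! ### A structured language for random access machines -/

/-- The variables of the structured language. -/
inductive Var : Type
  | len | word | pw | scale | expo | ell | pm | thr | pl | tau | span | base | cand | prog | dead
  | cnt | ctr | rest | pos | tmp | aux | rb | pc | code | argA | argB | argC | next | dest | val
  | valB
  deriving DecidableEq

/-- The register that holds a variable. The variables `len` and `word` occupy the registers `0` and
`1`, which hold the input length at the beginning and the output at the end. Register `2` belongs to
no variable: the compiler uses it for intermediate values. -/
def Var.idx : Var → ℕ
  | .len => 0 | .word => 1 | .pw => 3 | .scale => 4 | .expo => 5 | .ell => 6 | .pm => 7 | .thr => 8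
  | .pl => 9 | .tau => 10 | .span => 11 | .base => 12 | .cand => 13 | .prog => 14 | .dead => 15
  | .cnt => 16 | .ctr => 17 | .rest => 18 | .pos => 19 | .tmp => 20 | .aux => 21 | .rb => 22
  | .pc => 23 | .code => 24 | .argA => 25 | .argB => 26 | .argC => 27 | .next => 28 | .dest => 29
  | .val => 30 | .valB => 31

/-- The number of registers set aside for variables and for the compiler; the registers from
there on are the memory. -/
abbrev memStart : ℕ := 32

theorem Var.idx_lt (x : Var) : x.idx < memStart := by cases x <;> decide

theorem Var.idx_ne_two (x : Var) : x.idx ≠ 2 := by cases x <;> decide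

theorem Var.idx_injective : Function.Injective Var.idx := by
  intro x y h
  cases x <;> cases y <;> first | rfl | cases h

/-- A state of the structured language: the values of the variables and the contents of the
memory. -/
structure State : Type where
  var : Var → ℕ
  mem : ℕ → ℕ

/-- The primitive operations of the structured language. -/
inductive Op : Type
  /-- `x := n` -/
  | set (x : Var) (n : ℕ)
  /-- `x := y + z` -/
  | add (x y z : Var)
  /-- `x := y - z` -/
  | sub (x y z : Var)
  /-- `x := y + n` -/
  | addc (x y : Var) (n : ℕ)
  /-- `x := y - n` -/
  | subc (x y : Var) (n : ℕ)
  /-- `x := n - y` -/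
  | csub (x : Var) (n : ℕ) (y : Var)
  /-- `x := mem[y]` -/
  | load (x y : Var)
  /-- `mem[x] := y` -/
  | store (x y : Var)

/-- The effect of a primitive operation. -/
def Op.exec : Op → State → State
  | .set x n, σ => ⟨Function.update σ.var x n, σ.mem⟩
  | .add x y z, σ => ⟨Function.update σ.var x (σ.var y + σ.var z), σ.mem⟩
  | .sub x y z, σ => ⟨Function.update σ.var x (σ.var y - σ.var z), σ.mem⟩
  | .addc x y n, σ => ⟨Function.update σ.var x (σ.var y + n), σ.mem⟩
  | .subc x y n, σ => ⟨Function.update σ.var x (σ.var y - n), σ.mem⟩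
  | .csub x n y, σ => ⟨Function.update σ.var x (n - σ.var y), σ.mem⟩
  | .load x y, σ => ⟨Function.update σ.var x (σ.mem (σ.var y)), σ.mem⟩
  | .store x y, σ => ⟨σ.var, Function.update σ.mem (σ.var x) (σ.var y)⟩

section
variable (σ : State) (x y z r : Var) (n : ℕ)

@[simp] theorem Op.set_var :
    (Op.exec (.set x n) σ).var r = if r = x then n else σ.var r := by
  simp [Op.exec, Function.update_apply]

@[simp] theorem Op.add_var :
    (Op.exec (.add x y z) σ).var r = if r = x then σ.var y + σ.var z else σ.var r := by
  simp [Op.exec, Function.update_apply]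

@[simp] theorem Op.sub_var :
    (Op.exec (.sub x y z) σ).var r = if r = x then σ.var y - σ.var z else σ.var r := by
  simp [Op.exec, Function.update_apply]

@[simp] theorem Op.addc_var :
    (Op.exec (.addc x y n) σ).var r = if r = x then σ.var y + n else σ.var r := by
  simp [Op.exec, Function.update_apply]

@[simp] theorem Op.subc_var :
    (Op.exec (.subc x y n) σ).var r = if r = x then σ.var y - n else σ.var r := by
  simp [Op.exec, Function.update_apply]

@[simp] theorem Op.csub_var :
    (Op.exec (.csub x n y) σ).var r = if r = x then n - σ.var y else σ.var r := by
  simp [Op.exec, Function.update_apply]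

@[simp] theorem Op.load_var :
    (Op.exec (.load x y) σ).var r = if r = x then σ.mem (σ.var y) else σ.var r := by
  simp [Op.exec, Function.update_apply]

@[simp] theorem Op.store_var : (Op.exec (.store x y) σ).var r = σ.var r := rfl

@[simp] theorem Op.set_mem : (Op.exec (.set x n) σ).mem = σ.mem := rfl
@[simp] theorem Op.add_mem : (Op.exec (.add x y z) σ).mem = σ.mem := rfl
@[simp] theorem Op.sub_mem : (Op.exec (.sub x y z) σ).mem = σ.mem := rfl
@[simp] theorem Op.addc_mem : (Op.exec (.addc x y n) σ).mem = σ.mem := rfl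
@[simp] theorem Op.subc_mem : (Op.exec (.subc x y n) σ).mem = σ.mem := rfl
@[simp] theorem Op.csub_mem : (Op.exec (.csub x n y) σ).mem = σ.mem := rfl
@[simp] theorem Op.load_mem : (Op.exec (.load x y) σ).mem = σ.mem := rfl
@[simp] theorem Op.store_mem :
    (Op.exec (.store x y) σ).mem = Function.update σ.mem (σ.var x) (σ.var y) := rfl

end

/-- The machine code of a primitive operation. -/
def Op.code : Op → List Instr
  | .set x n => [.const x.idx n]
  | .add x y z => [.add x.idx y.idx z.idx]
  | .sub x y z => [.sub x.idx y.idx z.idx]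
  | .addc x y n => [.const 2 n, .add x.idx y.idx 2]
  | .subc x y n => [.const 2 n, .sub x.idx y.idx 2]
  | .csub x n y => [.const 2 n, .sub x.idx 2 y.idx]
  | .load x y => [.const 2 memStart, .add 2 y.idx 2, .load x.idx 2]
  | .store x y => [.const 2 memStart, .add 2 x.idx 2, .store 2 y.idx]

/-- The variable that a primitive operation may change, if any. -/
def Op.mods : Op → List Var
  | .set x _ | .add x _ _ | .sub x _ _ | .addc x _ _ | .subc x _ _ | .csub x _ _ | .load x _ => [x]
  | .store _ _ => []

/-- The commands of the structured language. Both control structures translate into a single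
conditional jump. -/
inductive Cmd : Type
  | skip
  | op (o : Op)
  | seq (a b : Cmd)
  /-- if `x = 0` then `a` -/
  | ifz (x : Var) (a : Cmd)
  /-- do `a` while `0 < x` -/
  | dowhile (a : Cmd) (x : Var)

/-- Sequential composition. -/
infixr:60 " ;; " => Cmd.seq

/-- The variables that a command may change. -/
def Cmd.mods : Cmd → List Var
  | .skip => []
  | .op o => o.mods
  | .seq a b => a.mods ++ b.mods
  | .ifz _ a => a.mods
  | .dowhile a _ => a.mods

/-- `Exec c σ τ t`: the command `c` leads from the state `σ` to the state `τ` in `t` machine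
steps. -/
inductive Exec : Cmd → State → State → ℕ → Prop
  | skip (σ) : Exec .skip σ σ 0
  | op (o : Op) (σ) : Exec (.op o) σ (o.exec σ) o.code.length
  | seq {a b σ τ ρ t t'} : Exec a σ τ t → Exec b τ ρ t' → Exec (a ;; b) σ ρ (t + t')
  | ifz_pos {x a σ} : 0 < σ.var x → Exec (.ifz x a) σ σ 1
  | ifz_zero {x a σ τ t} : σ.var x = 0 → Exec a σ τ t → Exec (.ifz x a) σ τ (1 + t)
  | last {x a σ τ t} : Exec a σ τ t → τ.var x = 0 → Exec (.dowhile a x) σ τ (t + 1)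
  | again {x a σ τ ρ t t'} : Exec a σ τ t → 0 < τ.var x → Exec (.dowhile a x) τ ρ t' →
      Exec (.dowhile a x) σ ρ (t + 1 + t')

theorem Exec.frame {c σ τ t} (h : Exec c σ τ t) {x : Var} (hx : x ∉ c.mods) :
    τ.var x = σ.var x := by
  induction h with
  | skip => rfl
  | op o σ => cases o <;> simp_all [Op.exec, Cmd.mods, Op.mods, Function.update_of_ne]
  | seq _ _ iha ihb =>
    simp only [Cmd.mods, List.mem_append, not_or] at hx
    rw [ihb hx.2, iha hx.1]
  | ifz_pos => rfl
  | ifz_zero _ _ ih => exact ih hx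
  | last _ _ ih => exact ih hx
  | again _ _ _ ih ih' => rw [ih' hx, ih hx]

/-! ### Compilation -/

/-- The machine code of a command that starts at line `l`. -/
def Cmd.code : Cmd → ℕ → List Instr
  | .skip, _ => []
  | .op o, _ => o.code
  | .seq a b, l => a.code l ++ b.code (l + (a.code l).length)
  | .ifz x a, l => .jpos x.idx (l + 1 + (a.code (l + 1)).length) :: a.code (l + 1)
  | .dowhile a x, l => a.code l ++ [.jpos x.idx l]

/-- The registers `R` represent the state `σ`; nothing is said about register `2`. -/
def Represents (R : ℕ → ℕ) (σ : State) : Prop :=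
  (∀ x : Var, R x.idx = σ.var x) ∧ ∀ a, R (memStart + a) = σ.mem a

/-- The code `l` is the part of the program `p` that starts at line `i`. -/
def CodeAt (p : Program) (i : ℕ) (l : List Instr) : Prop :=
  ∀ j < l.length, p[i + j]? = l[j]?

theorem CodeAt.left {p i l l'} (h : CodeAt p i (l ++ l')) : CodeAt p i l := by
  intro j hj
  rw [h j (by simp; omega), List.getElem?_append_left hj]

theorem CodeAt.right {p i l l'} (h : CodeAt p i (l ++ l')) : CodeAt p (i + l.length) l' := by
  intro j hj
  rw [add_assoc, h (l.length + j) (by simp; omega), List.getElem?_append_right (by omega)]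
  simp

theorem CodeAt.head {p i a l} (h : CodeAt p i (a :: l)) : p[i]? = some a := by
  simpa using h 0 (by simp)

theorem CodeAt.tail {p i a l} (h : CodeAt p i (a :: l)) : CodeAt p (i + 1) l :=
  CodeAt.right (l := [a]) h

/-- `p` leads from the configuration `c` to the configuration `c'` in `t` steps. -/
def Reaches (p : Program) (c : Config) (t : ℕ) (c' : Config) : Prop := (step p)^[t] c = c'

theorem Reaches.trans {p c c' c'' t t'} (h : Reaches p c t c') (h' : Reaches p c' t' c'') :
    Reaches p c (t + t') c'' := by
  unfold Reaches at *
  rw [add_comm, Function.iterate_add_apply, h, h']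

theorem Reaches.of_code {p : Program} {c : Config} {i : Instr} (h : p[c.pc]? = some i) :
    Reaches p c 1 (i.exec c) := by
  simp [Reaches, step, h]

theorem Represents.update {R : ℕ → ℕ} {σ : State} (h : Represents R σ) (x : Var) (n : ℕ) :
    Represents (Function.update R x.idx n) ⟨Function.update σ.var x n, σ.mem⟩ := by
  refine ⟨fun y => ?_, fun a => ?_⟩
  · by_cases hxy : y = x
    · subst hxy; simp
    · have : y.idx ≠ x.idx := fun h => hxy (Var.idx_injective h)
      simp [Function.update_of_ne, hxy, this, h.1]
  · have := x.idx_lt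
    rw [Function.update_of_ne (by omega), h.2]

theorem Represents.update_two {R : ℕ → ℕ} {σ : State} (h : Represents R σ) (n : ℕ) :
    Represents (Function.update R 2 n) σ := by
  refine ⟨fun y => ?_, fun a => ?_⟩
  · rw [Function.update_of_ne y.idx_ne_two, h.1]
  · rw [Function.update_of_ne (by simp [memStart]; omega), h.2]

theorem Represents.update_mem {R : ℕ → ℕ} {σ : State} (h : Represents R σ) (a n : ℕ) :
    Represents (Function.update R (memStart + a) n) ⟨σ.var, Function.update σ.mem a n⟩ := by
  refine ⟨fun y => ?_, fun b => ?_⟩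
  · have := y.idx_lt
    rw [Function.update_of_ne (by omega), h.1]
  · by_cases hab : b = a
    · subst hab; simp
    · rw [Function.update_of_ne (by omega), h.2]; simp [Function.update_of_ne, hab]

theorem Op.correct (o : Op) {p : Program} {l : ℕ} {R : ℕ → ℕ} {σ : State}
    (hp : CodeAt p l o.code) (hR : Represents R σ) :
    ∃ R', Represents R' (o.exec σ) ∧
      Reaches p ⟨l, R⟩ o.code.length ⟨l + o.code.length, R'⟩ := by
  have one {i : Instr} {R : ℕ → ℕ} {l : ℕ} (h : p[l]? = some i) :
      Reaches p ⟨l, R⟩ 1 (i.exec ⟨l, R⟩) :=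
    Reaches.of_code (c := ⟨l, R⟩) h
  cases o with
  | set x n => exact ⟨_, hR.update x n, one hp.head⟩
  | add x y z =>
    refine ⟨_, hR.update x _, ?_⟩
    rw [← hR.1 y, ← hR.1 z]
    exact one hp.head
  | sub x y z =>
    refine ⟨_, hR.update x _, ?_⟩
    rw [← hR.1 y, ← hR.1 z]
    exact one hp.head
  | addc x y n =>
    refine ⟨_, (hR.update_two n).update x _, ?_⟩
    have := (one (R := R) hp.head).trans (one hp.tail.head)
    simpa [Instr.exec, hR.1, Function.update_of_ne y.idx_ne_two, Op.code] using this
  | subc x y n =>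
    refine ⟨_, (hR.update_two n).update x _, ?_⟩
    have := (one (R := R) hp.head).trans (one hp.tail.head)
    simpa [Instr.exec, hR.1, Function.update_of_ne y.idx_ne_two, Op.code] using this
  | csub x n y =>
    refine ⟨_, (hR.update_two n).update x _, ?_⟩
    have := (one (R := R) hp.head).trans (one hp.tail.head)
    simpa [Instr.exec, hR.1, Function.update_of_ne y.idx_ne_two, Op.code] using this
  | load x y =>
    refine ⟨_, ((hR.update_two memStart).update_two (σ.var y + memStart)).update x _, ?_⟩
    have := ((one (R := R) hp.head).trans (one hp.tail.head)).trans (one hp.tail.tail.head)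
    have h := hR.2 (σ.var y)
    rw [add_comm] at h
    have h2 : σ.var y + 32 ≠ 2 := by omega
    simpa [Instr.exec, hR.1, h, h2, Function.update_of_ne y.idx_ne_two, Op.code] using this
  | store x y =>
    refine ⟨_, ((hR.update_two memStart).update_two (σ.var x + memStart)).update_mem
      (σ.var x) _, ?_⟩
    have := ((one (R := R) hp.head).trans (one hp.tail.head)).trans (one hp.tail.tail.head)
    simpa [Instr.exec, hR.1, Function.update_of_ne y.idx_ne_two,
      Function.update_of_ne x.idx_ne_two, Op.code, add_comm (σ.var x)] using this

/-- Correctness of the compiler: machine code does what the command says, in the same time. -/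
theorem Exec.correct {c σ τ t} (h : Exec c σ τ t) {p : Program} {l : ℕ} {R : ℕ → ℕ}
    (hp : CodeAt p l (c.code l)) (hR : Represents R σ) :
    ∃ R', Represents R' τ ∧ Reaches p ⟨l, R⟩ t ⟨l + (c.code l).length, R'⟩ := by
  induction h generalizing l R with
  | skip => exact ⟨R, hR, rfl⟩
  | op o σ => exact o.correct hp hR
  | seq _ _ iha ihb =>
    obtain ⟨R₁, h₁, r₁⟩ := iha hp.left hR
    obtain ⟨R₂, h₂, r₂⟩ := ihb hp.right h₁
    refine ⟨R₂, h₂, ?_⟩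
    simpa [Cmd.code, add_assoc] using r₁.trans r₂
  | ifz_pos hx =>
    refine ⟨R, hR, ?_⟩
    have := Reaches.of_code (c := ⟨l, R⟩) hp.head
    simpa [Instr.exec, hR.1, hx, Cmd.code, add_assoc, add_comm 1] using this
  | ifz_zero hx _ ih =>
    obtain ⟨R₁, h₁, r₁⟩ := ih hp.tail hR
    refine ⟨R₁, h₁, ?_⟩
    have := Reaches.of_code (c := ⟨l, R⟩) hp.head
    simp only [Instr.exec, hR.1, hx, lt_irrefl, if_false] at this
    simpa [Cmd.code, add_assoc, add_comm 1] using this.trans r₁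
  | last _ hx ih =>
    obtain ⟨R₁, h₁, r₁⟩ := ih hp.left hR
    refine ⟨R₁, h₁, ?_⟩
    have := Reaches.of_code (c := ⟨_, R₁⟩) hp.right.head
    simp only [Instr.exec, h₁.1, hx, lt_irrefl, if_false] at this
    simpa [Cmd.code, add_assoc] using r₁.trans this
  | again _ hx _ ih ih' =>
    obtain ⟨R₁, h₁, r₁⟩ := ih hp.left hR
    obtain ⟨R₂, h₂, r₂⟩ := ih' hp h₁
    refine ⟨R₂, h₂, ?_⟩
    have := Reaches.of_code (c := ⟨_, R₁⟩) hp.right.head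
    simp only [Instr.exec, h₁.1, hx, if_true] at this
    exact (r₁.trans this).trans r₂

/-! ### Weakest preconditions -/

/-- Weakest precondition with a clock: started in the state `σ` at time `t`, the command `c`
terminates, in a state `τ` at a time `t'` with `Q τ t'`. -/
def wp (c : Cmd) (σ : State) (t : ℕ) (Q : State → ℕ → Prop) : Prop :=
  ∃ τ t', Exec c σ τ t' ∧ Q τ (t + t')

@[simp] theorem wp_skip {σ t Q} : wp .skip σ t Q ↔ Q σ t :=
  ⟨fun ⟨_, _, h, hQ⟩ => by cases h; exact hQ, fun h => ⟨_, _, .skip σ, h⟩⟩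

@[simp] theorem wp_op {o σ t Q} : wp (.op o) σ t Q ↔ Q (o.exec σ) (t + o.code.length) :=
  ⟨fun ⟨_, _, h, hQ⟩ => by cases h; exact hQ, fun h => ⟨_, _, .op o σ, h⟩⟩

theorem wp_seq {a b σ t Q} :
    wp (a ;; b) σ t Q ↔ wp a σ t fun τ t' => wp b τ t' Q := by
  constructor
  · rintro ⟨_, _, h, hQ⟩
    cases h with
    | seq ha hb => exact ⟨_, _, ha, _, _, hb, by rwa [add_assoc]⟩
  · rintro ⟨_, _, ha, _, _, hb, hQ⟩
    exact ⟨_, _, .seq ha hb, by rwa [← add_assoc]⟩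

@[simp] theorem wp_ifz {x a σ t Q} :
    wp (.ifz x a) σ t Q ↔ if σ.var x = 0 then wp a σ (t + 1) Q else Q σ (t + 1) := by
  split_ifs with hx
  · constructor
    · rintro ⟨_, _, h, hQ⟩
      cases h with
      | ifz_pos h' => omega
      | ifz_zero _ h => exact ⟨_, _, h, by rwa [add_assoc]⟩
    · rintro ⟨_, _, h, hQ⟩
      exact ⟨_, _, .ifz_zero hx h, by rwa [← add_assoc]⟩
  · constructor
    · rintro ⟨_, _, h, hQ⟩
      cases h with
      | ifz_pos h' => exact hQ
      | ifz_zero h' h => omega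
    · exact fun hQ => ⟨_, _, .ifz_pos (by omega), hQ⟩

@[simp] theorem wp_op_seq {o a σ t Q} :
    wp (.op o ;; a) σ t Q ↔ wp a (o.exec σ) (t + o.code.length) Q := by
  rw [wp_seq, wp_op]

@[simp] theorem wp_seq_assoc {a b c σ t Q} :
    wp ((a ;; b) ;; c) σ t Q ↔ wp (a ;; b ;; c) σ t Q := by
  simp only [wp_seq]

@[simp] theorem wp_ifz_seq {x a b σ t Q} :
    wp (.ifz x a ;; b) σ t Q ↔
      if σ.var x = 0 then wp (a ;; b) σ (t + 1) Q else wp b σ (t + 1) Q := by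
  rw [wp_seq, wp_ifz, wp_seq]

theorem wp_mono {c σ t Q Q'} (h : wp c σ t Q) (hQ : ∀ τ t', Q τ t' → Q' τ t') : wp c σ t Q' := by
  obtain ⟨τ, t', h, hq⟩ := h
  exact ⟨τ, t', h, hQ _ _ hq⟩

/-- Variables that a command does not assign to keep their values. -/
theorem wp_frame {c σ t Q}
    (h : wp c σ t fun τ t' => (∀ x ∉ c.mods, τ.var x = σ.var x) → Q τ t') : wp c σ t Q := by
  obtain ⟨τ, t', h, hq⟩ := h
  exact ⟨τ, t', h, hq fun x hx => h.frame hx⟩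

/-- The clock may be started at any time. -/
theorem wp_shift {c : Cmd} {σ : State} {Q : State → Prop} {n : ℕ}
    (h : wp c σ 0 fun τ t' => t' ≤ n ∧ Q τ) (t : ℕ) :
    wp c σ t fun τ t' => t' ≤ t + n ∧ Q τ := by
  obtain ⟨τ, t', h, hn, hq⟩ := h
  exact ⟨τ, t', h, by omega, hq⟩

/-- The rule for loops: if `I k` is the invariant when at most `k` further rounds remain, and a
round takes at most `n` steps, then the loop takes at most `(k + 1) * (n + 1)` steps. The invariant
need not mention the variables that the body does not assign to. -/
theorem wp_dowhile {a : Cmd} {x : Var} {n : ℕ} {σ : State} (I : ℕ → State → Prop)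
    (P : State → Prop)
    (h : ∀ k τ, (∀ r ∉ a.mods, τ.var r = σ.var r) → I k τ → wp a τ 0 fun ρ t => t ≤ n ∧
      ((ρ.var x = 0 ∧ P ρ) ∨ (0 < ρ.var x ∧ ∃ k', k = k' + 1 ∧ I k' ρ)))
    {k : ℕ} (hσ : I k σ) :
    wp (.dowhile a x) σ 0 fun τ t => t ≤ (k + 1) * (n + 1) ∧ P τ := by
  induction k generalizing σ with
  | zero =>
    obtain ⟨τ, t, he, ht, ⟨h0, hP⟩ | ⟨_, k', hk, _⟩⟩ := h _ _ (fun _ _ => rfl) hσ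
    · exact ⟨τ, _, .last he h0, by omega, hP⟩
    · omega
  | succ k ih =>
    obtain ⟨τ, t, he, ht, ⟨h0, hP⟩ | ⟨h0, k', hk, hI⟩⟩ := h _ _ (fun _ _ => rfl) hσ
    · refine ⟨τ, _, .last he h0, ?_, hP⟩
      have : 1 * (n + 1) ≤ (k + 1 + 1) * (n + 1) := Nat.mul_le_mul_right _ (by omega)
      omega
    · obtain rfl : k' = k := by omega
      obtain ⟨ρ, t', he', ht', hP⟩ := ih (σ := τ)
        (fun k ρ hf => h k ρ fun r hr => by rw [hf r hr, he.frame hr]) hI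
      refine ⟨ρ, _, .again he h0 he', ?_, hP⟩
      have : (k' + 1 + 1) * (n + 1) = (k' + 1) * (n + 1) + (n + 1) := by ring
      omega

/-- do `a` and decrement `x`, while `0 < x` -/
def Cmd.loop (x : Var) (a : Cmd) : Cmd := .dowhile (a ;; .op (.subc x x 1)) x

/-- The rule for counting loops: `I k` is the invariant when `k` rounds remain. It must not
depend on the counter `x`, which is why it has to survive a decrement of `x`. -/
theorem wp_loop {a : Cmd} {x : Var} {n : ℕ} {σ : State} (I : ℕ → State → Prop) (hx : x ∉ a.mods)
    (hI : ∀ k τ j, I k τ → I k ((Op.subc x x j).exec τ))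
    (h : ∀ k τ, (∀ r, r ∉ a.mods → r ≠ x → τ.var r = σ.var r) → I (k + 1) τ → τ.var x = k + 1 →
      wp a τ 0 fun ρ t => t ≤ n ∧ I k ρ)
    {k : ℕ} (hk : σ.var x = k) (h0 : 0 < k) (hσ : I k σ) :
    wp (.loop x a) σ 0 fun τ t => t ≤ k * (n + 3) ∧ I 0 τ := by
  obtain ⟨k, rfl⟩ : ∃ k', k = k' + 1 := ⟨k - 1, by omega⟩
  refine wp_dowhile (n := n + 2) (fun k τ => I (k + 1) τ ∧ τ.var x = k + 1) (I 0) ?_ ⟨hσ, hk⟩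
  rintro k τ hfr ⟨hτ, hk⟩
  rw [wp_seq]
  refine wp_frame (wp_mono (h k τ (fun r hr hrx => hfr r ?_) hτ hk) ?_)
  · simp [Cmd.mods, Op.mods, hr, hrx]
  rintro ρ t ⟨ht, hρ⟩ hf
  have hxk : ρ.var x = k + 1 := by rw [hf x hx, hk]
  rw [wp_op]
  refine ⟨by simpa [Op.code] using ht, ?_⟩
  rcases k with _ | k
  · left
    exact ⟨by simp [hxk], hI _ _ _ hρ⟩
  · right
    exact ⟨by simp [hxk], k, rfl, hI _ _ _ hρ, by simp [hxk]⟩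

/-! ### Programs as arrays of numbers -/

/-- The instruction with the given operation code and operands; the code `0` means "halt". -/
def decodeInstr : ℕ → ℕ → ℕ → ℕ → Option Instr
  | 0, _, _, _ => none
  | 1, a, b, _ => some (.const a b)
  | 2, a, b, c => some (.add a b c)
  | 3, a, b, c => some (.sub a b c)
  | 4, a, b, _ => some (.load a b)
  | 5, a, b, _ => some (.store a b)
  | _ + 6, a, b, _ => some (.jpos a b)

/-- One step of the machine whose program is given by the array `arr`, four entries per line. -/
def simStep (arr : ℕ → ℕ) (c : Config) : Config :=
  match decodeInstr (arr (4 * c.pc)) (arr (4 * c.pc + 1)) (arr (4 * c.pc + 2))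
      (arr (4 * c.pc + 3)) with
  | none => c
  | some i => i.exec c

/-- Operation code and operands of an instruction. -/
def encodeInstr : Instr → List ℕ
  | .const a b => [1, a, b, 0]
  | .add a b c => [2, a, b, c]
  | .sub a b c => [3, a, b, c]
  | .load a b => [4, a, b, 0]
  | .store a b => [5, a, b, 0]
  | .jpos a b => [6, a, b, 0]

/-- The array of a program, with zeros after its end. -/
def progArray (p : Program) (i : ℕ) : ℕ := (p.flatMap encodeInstr).getD i 0

theorem progArray_cons (i : Instr) (p : Program) (j : ℕ) :
    progArray (i :: p) (4 + j) = progArray p j := by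
  cases i <;> simp [progArray, encodeInstr, List.getD, add_comm 4 j]

theorem decodeInstr_progArray (p : Program) (l : ℕ) :
    decodeInstr (progArray p (4 * l)) (progArray p (4 * l + 1)) (progArray p (4 * l + 2))
      (progArray p (4 * l + 3)) = p[l]? := by
  induction p generalizing l with
  | nil => rfl
  | cons i p ih =>
    cases l with
    | zero => cases i <;> rfl
    | succ l =>
      rw [List.getElem?_cons_succ, ← ih l, show 4 * (l + 1) = 4 + 4 * l by ring]
      simp only [add_assoc, progArray_cons]

theorem simStep_progArray (p : Program) : simStep (progArray p) = step p := by
  funext c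
  rw [simStep, decodeInstr_progArray, step]

theorem progArray_eq_zero_iff (p : Program) (l : ℕ) : progArray p (4 * l) = 0 ↔ p.length ≤ l := by
  rw [← List.getElem?_eq_none_iff, ← decodeInstr_progArray]
  constructor
  · intro h; rw [h]; rfl
  · intro h
    rcases h' : progArray p (4 * l) with _ | _ | _ | _ | _ | _ | n
    · rfl
    all_goals rw [h'] at h; cases h

/-! ### Arrays as bit strings -/

/-- Arrays are encoded in unary by the binary digits of `u` below `2 ^ k`, the highest digit first:
a one increments the current entry, a zero moves on to the next entry. -/
def readBits (u : ℕ) : ℕ → ℕ → (ℕ → ℕ) → ℕ → ℕ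
  | 0, _, arr => arr
  | k + 1, pos, arr =>
    if u.testBit k then readBits u k pos (Function.update arr pos (arr pos + 1))
    else readBits u k (pos + 1) arr

theorem readBits_congr {u u' k pos arr} (h : ∀ i < k, u.testBit i = u'.testBit i) :
    readBits u k pos arr = readBits u' k pos arr := by
  induction k generalizing pos arr with
  | zero => rfl
  | succ k ih =>
    simp only [readBits, h k (by omega), ih fun i hi => h i (by omega)]

theorem readBits_zero (k pos : ℕ) (arr : ℕ → ℕ) : readBits 0 k pos arr = arr := by
  induction k generalizing pos with
  | zero => rfl
  | succ k ih => simp [readBits, ih]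

/-- The list `l` is encoded by the word `1 ^ l₀ 0 1 ^ l₁ 0 ⋯`, filled up with zeros at its end. -/
theorem exists_readBits (l : List ℕ) : ∃ n, ∀ k ≥ n, ∃ u < 2 ^ k, ∀ pos arr,
    readBits u k pos arr = fun i => arr i + if pos ≤ i then l.getD (i - pos) 0 else 0 := by
  induction l with
  | nil => exact ⟨0, fun k _ => ⟨0, by positivity, fun pos arr => by simp [readBits_zero]⟩⟩
  | cons a l ih =>
    obtain ⟨n, hn⟩ := ih
    induction a with
    | zero =>
      refine ⟨n + 1, fun k hk => ?_⟩
      obtain ⟨k, rfl⟩ : ∃ k', k = k' + 1 := ⟨k - 1, by omega⟩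
      obtain ⟨u, hu, h⟩ := hn k (by omega)
      refine ⟨u, by rw [pow_succ]; omega, fun pos arr => ?_⟩
      rw [readBits, Nat.testBit_lt_two_pow hu, if_neg (by simp), h]
      funext i
      rcases lt_trichotomy i pos with hi | rfl | hi
      · rw [if_neg (by omega), if_neg (by omega)]
      · simp
      · rw [if_pos (by omega), if_pos (by omega), show i - pos = (i - (pos + 1)) + 1 by omega]
        simp
    | succ a iha =>
      obtain ⟨n', hn'⟩ := iha
      refine ⟨n' + 1, fun k hk => ?_⟩
      obtain ⟨k, rfl⟩ : ∃ k', k = k' + 1 := ⟨k - 1, by omega⟩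
      obtain ⟨u, hu, h⟩ := hn' k (by omega)
      refine ⟨2 ^ k + u, by rw [pow_succ]; omega, fun pos arr => ?_⟩
      rw [readBits, Nat.testBit_two_pow_add_eq, Nat.testBit_lt_two_pow hu, if_pos (by simp),
        readBits_congr (u' := u) fun i hi => Nat.testBit_two_pow_add_gt hi u, h]
      funext i
      rcases lt_trichotomy i pos with hi | rfl | hi
      · rw [if_neg (by omega), if_neg (by omega), Function.update_of_ne (by omega)]
      · simp; ring
      · rw [if_pos (by omega), if_pos (by omega), show i - pos = (i - (pos + 1)) + 1 by omega,
          Function.update_of_ne (by omega)]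
        simp

theorem readBits_le {u k pos arr n} (h : ∀ i, arr i ≤ n) (i : ℕ) :
    readBits u k pos arr i ≤ n + k := by
  induction k generalizing pos arr n with
  | zero => exact h i
  | succ k ih =>
    rw [readBits]
    split_ifs
    · have : ∀ i, Function.update arr pos (arr pos + 1) i ≤ n + 1 := by
        intro i
        rw [Function.update_apply]
        split_ifs
        · exact Nat.succ_le_succ (h _)
        · exact (h i).trans (by omega)
      exact (ih this).trans (by omega)
    · exact (ih h).trans (by omega)

theorem readBits_eq_zero {u k pos arr i} (h : arr i = 0) (hi : pos + k < i) :
    readBits u k pos arr i = 0 := by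
  induction k generalizing pos arr with
  | zero => exact h
  | succ k ih =>
    rw [readBits]
    split_ifs
    · refine ih ?_ (by omega)
      rw [Function.update_of_ne (by omega), h]
    · exact ih h (by omega)

/-- The array encoded by the lowest `k` binary digits of `u`. -/
def codeArray (k u : ℕ) : ℕ → ℕ := readBits u k 0 fun _ => 0

theorem codeArray_le (k u i : ℕ) : codeArray k u i ≤ k := by
  simpa [codeArray] using readBits_le (u := u) (k := k) (pos := 0) (arr := fun _ => 0) (n := 0)
    (fun _ => le_rfl) i

theorem codeArray_eq_zero {k u i : ℕ} (h : k < i) : codeArray k u i = 0 :=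
  readBits_eq_zero rfl (by omega)

/-- Every program is encoded by some number, as soon as there are enough digits. -/
theorem exists_codeArray (p : Program) :
    ∃ n, ∀ k ≥ n, ∃ u < 2 ^ k, codeArray k u = progArray p := by
  obtain ⟨n, h⟩ := exists_readBits (p.flatMap encodeInstr)
  refine ⟨n, fun k hk => ?_⟩
  obtain ⟨u, hu, h⟩ := h k hk
  refine ⟨u, hu, ?_⟩
  rw [codeArray, h]
  funext i
  simp [progArray]

/-! ### How far a computation can reach -/

/-- All registers hold values at most `n`, and the registers after `n` hold `0`. -/
def Config.Bounded (c : Config) (n : ℕ) : Prop := (∀ j, c.reg j ≤ n) ∧ ∀ j, n < j → c.reg j = 0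

theorem Config.Bounded.update {pc pc' R n i a} (h : Config.Bounded ⟨pc, R⟩ n) (hi : i ≤ n)
    (ha : a ≤ 2 * n) : Config.Bounded ⟨pc', Function.update R i a⟩ (2 * n) := by
  refine ⟨fun j => ?_, fun j hj => ?_⟩
  · simp only [Function.update_apply]
    split_ifs
    · exact ha
    · exact (h.1 j).trans (by omega)
  · show Function.update R i a j = 0
    rw [Function.update_of_ne (by omega)]
    exact h.2 j (by omega)

/-- One step at most doubles the values and addresses that occur. -/
theorem Config.Bounded.simStep {arr : ℕ → ℕ} {n : ℕ} (harr : ∀ i, arr i ≤ n) {c : Config}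
    (h : c.Bounded n) : (simStep arr c).Bounded (2 * n) := by
  have hc : c.Bounded (2 * n) := ⟨fun j => (h.1 j).trans (by omega), fun j hj => h.2 j (by omega)⟩
  have h1 := harr (4 * c.pc + 1)
  have h2 := harr (4 * c.pc + 2)
  rw [OfflineOnline.simStep]
  generalize arr (4 * c.pc + 1) = x at *
  generalize arr (4 * c.pc + 2) = y at *
  generalize arr (4 * c.pc + 3) = z at *
  have hy := h.1 y
  have hz := h.1 z
  rcases arr (4 * c.pc) with _ | _ | _ | _ | _ | _ | k
  · exact hc
  · exact h.update h1 (by omega)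
  · exact h.update h1 (by omega)
  · exact h.update h1 (by omega)
  · exact h.update h1 ((h.1 _).trans (by omega))
  · exact h.update (h.1 _) (by omega)
  · exact hc

theorem Config.Bounded.iterate {arr : ℕ → ℕ} {n : ℕ} (harr : ∀ i, arr i ≤ n) {c : Config}
    (h : c.Bounded n) (t : ℕ) : ((OfflineOnline.simStep arr)^[t] c).Bounded (2 ^ t * n) := by
  induction t with
  | zero => simpa using h
  | succ t ih =>
    rw [Function.iterate_succ_apply', pow_succ, mul_comm _ 2, mul_assoc]
    exact ih.simStep fun i => (harr i).trans (Nat.le_mul_of_pos_left _ (by positivity))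

/-! ### The interpreter -/

section
open Op Var

/-- if `code = n` then `a` -/
def Cmd.onCode (n : ℕ) (a : Cmd) : Cmd :=
  .op (csub tmp n .code) ;; .op (subc aux .code n) ;; .op (add tmp tmp aux) ;; .ifz tmp a

/-- Fetch the current instruction, its operands, and the contents of the registers concerned. By
default the instruction writes the register of its first operand back unchanged. -/
def fetchCmd : Cmd :=
  .op (load .code pc) ;; .op (addc tmp pc 2) ;; .op (load argA tmp) ;; .op (addc tmp tmp 2) ;;
  .op (load argB tmp) ;; .op (addc tmp tmp 2) ;; .op (load argC tmp) ;; .op (addc next tmp 2) ;;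
  .op (add dest argA argA) ;; .op (add dest dest rb) ;; .op (load val dest) ;;
  .op (add tmp argB argB) ;; .op (add tmp tmp rb) ;; .op (load valB tmp) ;;
  .op (add tmp argC argC) ;; .op (add tmp tmp rb) ;; .op (load argC tmp)

/-- Determine the address to be written, the value to be written, and the next line. -/
def dispatchCmd : Cmd :=
  .onCode 0 (.op (addc next pc 0)) ;;
  .onCode 1 (.op (addc val argB 0)) ;;
  .onCode 2 (.op (add val valB argC)) ;;
  .onCode 3 (.op (sub val valB argC)) ;;
  .onCode 4 (.op (add tmp valB valB) ;; .op (add tmp tmp rb) ;; .op (load val tmp)) ;;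
  .onCode 5 (.op (add dest val val) ;; .op (add dest dest rb) ;; .op (addc val valB 0)) ;;
  .op (csub tmp 6 .code) ;;
  .ifz tmp (.op (csub tmp 1 val) ;; .ifz tmp (.op (add next argB argB) ;;
    .op (add next next next) ;; .op (add next next next) ;; .op (add next next base)))

/-- One step of the simulated machine. The variables `pc` and `next` hold the addresses of lines; as
a line has four entries, at even places only, the line `l` has the address `base + 8 * l`. -/
def stepCmd : Cmd :=
  fetchCmd ;; dispatchCmd ;; .op (store dest val) ;; .op (addc pc next 0)

end

/-- The memory from `b` on holds the code array `arr` at even places and the registers `R` of a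
simulated machine at odd places. -/
structure Layout (b : ℕ) (arr R mem : ℕ → ℕ) : Prop where
  code : ∀ i, mem (b + 2 * i) = arr i
  reg : ∀ j, mem (b + 1 + 2 * j) = R j

theorem Layout.update_reg {b arr R mem} (h : Layout b arr R mem) (j n : ℕ) :
    Layout b arr (Function.update R j n) (Function.update mem (b + 1 + 2 * j) n) := by
  refine ⟨fun i => ?_, fun i => ?_⟩
  · rw [Function.update_of_ne (by omega), h.code]
  · simp only [Function.update_apply, h.reg]
    congr 1
    simp

theorem wp_fetch {b : ℕ} {arr : ℕ → ℕ} {c : Config} {σ : State} (hb : σ.var .rb = b + 1)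
    (hpc : σ.var .pc = b + 8 * c.pc) (hmem : Layout b arr c.reg σ.mem) :
    wp fetchCmd σ 0 fun τ t => t ≤ 37 ∧ τ.mem = σ.mem ∧ τ.var .code = arr (4 * c.pc) ∧
      τ.var .argB = arr (4 * c.pc + 2) ∧ τ.var .dest = b + 1 + 2 * arr (4 * c.pc + 1) ∧
      τ.var .val = c.reg (arr (4 * c.pc + 1)) ∧ τ.var .valB = c.reg (arr (4 * c.pc + 2)) ∧
      τ.var .argC = c.reg (arr (4 * c.pc + 3)) ∧ τ.var .next = b + 8 * (c.pc + 1) := by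
  have h0 : σ.mem (b + 8 * c.pc) = arr (4 * c.pc) := by rw [← hmem.code]; congr 1; ring
  have h1 : σ.mem (b + (8 * c.pc + 2)) = arr (4 * c.pc + 1) := by rw [← hmem.code]; congr 1; ring
  have h2 : σ.mem (b + (8 * c.pc + 4)) = arr (4 * c.pc + 2) := by rw [← hmem.code]; congr 1; ring
  have h3 : σ.mem (b + (8 * c.pc + 6)) = arr (4 * c.pc + 3) := by rw [← hmem.code]; congr 1; ring
  have hr : ∀ j, σ.mem (j + (j + (b + 1))) = c.reg j := fun j => by
    rw [← hmem.reg]; congr 1; ring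
  simp [fetchCmd, Op.code, hb, hpc, add_assoc, h0, h1, h2, h3, hr]
  omega

theorem wp_dispatch {b : ℕ} {arr : ℕ → ℕ} {c : Config} {σ : State} (hb : σ.var .rb = b + 1)
    (hbase : σ.var .base = b)
    (hpc : σ.var .pc = b + 8 * c.pc) (hmem : Layout b arr c.reg σ.mem)
    (h0 : σ.var .code = arr (4 * c.pc))
    (h2 : σ.var .argB = arr (4 * c.pc + 2)) (h1 : σ.var .dest = b + 1 + 2 * arr (4 * c.pc + 1))
    (hv1 : σ.var .val = c.reg (arr (4 * c.pc + 1))) (hv2 : σ.var .valB = c.reg (arr (4 * c.pc + 2)))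
    (hv3 : σ.var .argC = c.reg (arr (4 * c.pc + 3))) (hn : σ.var .next = b + 8 * (c.pc + 1)) :
    wp dispatchCmd σ 0 fun τ t => t ≤ 100 ∧ τ.mem = σ.mem ∧
      τ.var .next = b + 8 * (simStep arr c).pc ∧ ∃ j, τ.var .dest = b + 1 + 2 * j ∧
        (simStep arr c).reg = Function.update c.reg j (τ.var .val) := by
  have hr : ∀ j, σ.mem (j + j + (b + 1)) = c.reg j := fun j => by
    rw [← hmem.reg]; congr 1; ring
  rw [simStep]
  generalize arr (4 * c.pc) = o at *
  generalize arr (4 * c.pc + 1) = x at *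
  generalize arr (4 * c.pc + 2) = y at *
  generalize arr (4 * c.pc + 3) = z at *
  rcases o with _ | _ | _ | _ | _ | _ | k
  · simp [dispatchCmd, Cmd.onCode, Op.code, decodeInstr, *]
  · simp [dispatchCmd, Cmd.onCode, Op.code, decodeInstr, Instr.exec, *]
  · simp [dispatchCmd, Cmd.onCode, Op.code, decodeInstr, Instr.exec, *]
  · simp [dispatchCmd, Cmd.onCode, Op.code, decodeInstr, Instr.exec, *]
  · simp [dispatchCmd, Cmd.onCode, Op.code, decodeInstr, Instr.exec, *]
  · simp [dispatchCmd, Cmd.onCode, Op.code, decodeInstr, Instr.exec, *]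
    exact ⟨c.reg x, by ring, rfl⟩
  · simp [dispatchCmd, Cmd.onCode, Op.code, decodeInstr, Instr.exec, *]
    split_ifs <;> omega

/-- The interpreter is correct: it simulates one step of the simulated machine. -/
theorem wp_step {b : ℕ} {arr : ℕ → ℕ} {c : Config} {σ : State} (hb : σ.var .rb = b + 1)
    (hbase : σ.var .base = b) (hpc : σ.var .pc = b + 8 * c.pc) (hmem : Layout b arr c.reg σ.mem) :
    wp stepCmd σ 0 fun τ t => t ≤ 150 ∧ τ.var .pc = b + 8 * (simStep arr c).pc ∧
      Layout b arr (simStep arr c).reg τ.mem ∧ ∀ i < b, τ.mem i = σ.mem i := by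
  rw [stepCmd, wp_seq]
  refine wp_frame (wp_mono (wp_fetch hb hpc hmem) ?_)
  rintro τ t ⟨ht, hm, h0, h2, h1, hv1, hv2, hv3, hn⟩ hf
  rw [← hm] at hmem
  rw [wp_seq]
  refine wp_mono (wp_shift (wp_mono (wp_dispatch (by rw [hf _ (by decide), hb])
    (by rw [hf _ (by decide), hbase]) (by rw [hf _ (by decide), hpc]) hmem h0 h2 h1 hv1 hv2 hv3 hn)
    fun _ _ h => h) t) ?_
  rintro ρ t' ⟨ht', hm', hn', j, hj, hreg⟩
  simp only [wp_op_seq, wp_op, Op.addc_var, Op.addc_mem, Op.store_var, Op.store_mem, hj, hn', hreg,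
    Op.code, List.length, hm', if_true, add_zero, true_and]
  refine ⟨by omega, hmem.update_reg _ _, fun i hi => ?_⟩
  rw [Function.update_of_ne (by omega), hm]

/-! ### Running one program on one string -/

section
open Op Var

/-- Write the code array of the program number `prog` into the memory. In each round the variable
`rest` is doubled, and the next binary digit is one if this makes it reach `pm = 2 ^ scale`. -/
def decodeCmd : Cmd :=
  .op (addc pos base 0) ;; .op (addc rest prog 0) ;; .op (addc ctr scale 0) ;;
  .loop ctr (.op (add rest rest rest) ;; .op (sub tmp pm rest) ;; .op (addc pos pos 2) ;;
    .ifz tmp (.op (sub rest rest pm) ;; .op (subc pos pos 2) ;; .op (load aux pos) ;;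
      .op (addc aux aux 1) ;; .op (store pos aux)))

/-- Write the initial registers for the input string number `cand` and the accuracy `1 / 2` into the
memory, the last bit of the string first. -/
def inputCmd : Cmd :=
  .op (addc rb base 1) ;; .op (store rb ell) ;; .op (addc tmp rb 2) ;; .op (set aux 1) ;;
  .op (store tmp aux) ;; .op (addc tmp tmp 2) ;; .op (set aux 2) ;; .op (store tmp aux) ;;
  .op (add pos ell ell) ;; .op (add pos pos rb) ;; .op (addc pos pos 6) ;;
  .op (addc rest cand 0) ;; .op (addc ctr ell 0) ;;
  .loop ctr (.op (add rest rest rest) ;; .op (sub tmp pl rest) ;; .op (subc pos pos 2) ;;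
    .ifz tmp (.op (sub rest rest pl) ;; .op (set aux 1) ;; .op (store pos aux)))

/-- Simulate `tau` steps; a machine that has halted earlier stays as it is. -/
def simulateCmd : Cmd := .op (addc pc base 0) ;; .op (addc ctr tau 0) ;; .loop ctr stepCmd

/-- Read the output, and multiply its numerator by `2 ^ expo`. Since operation codes of programs are
positive, the operation code at the final line is zero if and only if the machine has halted. -/
def outputCmd : Cmd :=
  .op (load .code pc) ;; .op (load argA rb) ;; .op (addc tmp rb 2) ;; .op (load argB tmp) ;;
  .op (addc ctr expo 0) ;; .loop ctr (.op (add argA argA argA))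

/-- Run the program number `prog` on the string number `cand`. -/
def runCmd : Cmd := decodeCmd ;; inputCmd ;; simulateCmd ;; outputCmd

end

/-- Doubling shifts the next binary digit of `u` to the position `m`. -/
theorem double_mod {u k m : ℕ} (h : k < m) :
    u % 2 ^ (k + 1) * 2 ^ (m - (k + 1)) + u % 2 ^ (k + 1) * 2 ^ (m - (k + 1)) =
      u % 2 ^ k * 2 ^ (m - k) + if u.testBit k then 2 ^ m else 0 := by
  have h1 : 2 ^ (m - k) = 2 * 2 ^ (m - (k + 1)) := by
    rw [← pow_succ']; congr 1; omega
  have h2 : 2 ^ m = 2 ^ k * 2 ^ (m - k) := by rw [← pow_add]; congr 1; omega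
  rw [h2, Nat.mod_pow_succ, Nat.testBit_eq_decide_div_mod_eq, h1]
  rcases Nat.mod_two_eq_zero_or_one (u / 2 ^ k) with h | h
  · simp [h]; ring
  · simp [h]; ring

theorem mod_mul_lt {u k m : ℕ} (h : k ≤ m) : u % 2 ^ k * 2 ^ (m - k) < 2 ^ m := by
  have h2 : 2 ^ m = 2 ^ k * 2 ^ (m - k) := by rw [← pow_add]; congr 1; omega
  rw [h2]
  exact Nat.mul_lt_mul_of_pos_right (Nat.mod_lt _ (by positivity)) (by positivity)

theorem wp_decode {b m u : ℕ} {σ : State} (hb : σ.var .base = b) (hm : σ.var .scale = m)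
    (hu : σ.var .prog = u) (hpm : σ.var .pm = 2 ^ m) (hum : u < 2 ^ m) (hm0 : 0 < m)
    (hmem : ∀ a, b ≤ a → σ.mem a = 0) :
    wp decodeCmd σ 0 fun τ t => t ≤ m * 19 + 6 ∧
      Layout b (codeArray m u) (fun _ => 0) τ.mem ∧ ∀ i < b, τ.mem i = σ.mem i := by
  have key := wp_loop (a := .op (.add .rest .rest .rest) ;; .op (.sub .tmp .pm .rest) ;;
      .op (.addc .pos .pos 2) ;; .ifz .tmp (.op (.sub .rest .rest .pm) ;; .op (.subc .pos .pos 2) ;;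
      .op (.load .aux .pos) ;; .op (.addc .aux .aux 1) ;; .op (.store .pos .aux)))
    (x := .ctr) (n := 16)
    (σ := (Op.addc .ctr .scale 0).exec ((Op.addc .rest .prog 0).exec
      ((Op.addc .pos .base 0).exec σ)))
    (fun k τ => k ≤ m ∧ τ.var .rest = u % 2 ^ k * 2 ^ (m - k) ∧ ∃ p arr, τ.var .pos = b + 2 * p ∧
      readBits u k p arr = codeArray m u ∧ Layout b arr (fun _ => 0) τ.mem ∧
      ∀ i < b, τ.mem i = σ.mem i) (by decide)
    (by simp) ?_ (k := m) (by simp [hm]) hm0 ?_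
  · rw [decodeCmd, wp_op_seq, wp_op_seq, wp_op_seq]
    refine wp_mono (wp_shift key _) ?_
    rintro τ t ⟨ht, -, -, p, arr, -, harr, hL, hi⟩
    refine ⟨by simp [Op.code] at ht; omega, ?_, hi⟩
    rw [← harr]; exact hL
  · rintro k τ hf ⟨hk, hr, p, arr, hp, harr, hL, hi⟩ -
    have hpm' : τ.var .pm = 2 ^ m := by rw [hf _ (by decide) (by decide)]; simpa using hpm
    have hd := double_mod (u := u) (Nat.lt_of_succ_le hk)
    have hlt := mod_mul_lt (u := u) (Nat.le_of_succ_le hk)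
    rw [← hr] at hd
    rw [readBits] at harr
    split_ifs at hd harr with hbit
    · simp [Op.code, hp, hpm', hd]
      refine ⟨by omega, _, harr, ?_, ?_⟩
      · refine ⟨fun i => ?_, fun j => ?_⟩
        · simp only [Function.update_apply, hL.code]; congr 1; simp
        · rw [Function.update_of_ne (by omega), hL.reg]
      · intro i hib
        rw [Function.update_of_ne (by omega), hi i hib]
    · have : ¬ 2 ^ m ≤ u % 2 ^ k * 2 ^ (m - k) := by omega
      simp [Op.code, hp, hpm', hd, Nat.sub_eq_zero_iff_le, this]
      exact ⟨by omega, p + 1, by ring, arr, harr, hL, hi⟩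
  · simp [hu, hb, Nat.mod_eq_of_lt hum]
    exact ⟨fun _ => 0, rfl, ⟨fun i => hmem _ (by omega), fun j => hmem _ (by omega)⟩⟩

/-- The string of length `l` that consists of the binary digits of `z`, the lowest digit first. -/
def bitString (l z : ℕ) : List Bool := List.ofFn fun i : Fin l => z.testBit i

/-- The initial registers for the input `bitString l z` and the accuracy `1 / 2`, in which the first
`k` bits of the input are still missing. -/
def inputRegs (l z k : ℕ) : ℕ → ℕ
  | 0 => l
  | 1 => 1
  | 2 => 2
  | i + 3 => if k ≤ i then (z.testBit i).toNat else 0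

theorem initial_bitString {l z : ℕ} (hz : z < 2 ^ l) :
    (initial (bitString l z) (1 / 2)).reg = inputRegs l z 0 := by
  funext i
  rcases i with _ | _ | _ | i
  · simp [initial, inputRegs, bitString]
  · simp [initial, inputRegs]; rfl
  · simp [initial, inputRegs]
  · simp only [initial, inputRegs, bitString, Nat.zero_le, if_true]
    by_cases hi : i < l
    · simp [List.getD, hi]
    · rw [Nat.testBit_lt_two_pow (hz.trans_le (Nat.pow_le_pow_right (by norm_num) (by omega)))]
      simp [List.getD, hi]

theorem inputRegs_pred {l z k : ℕ} :
    inputRegs l z k = Function.update (inputRegs l z (k + 1)) (3 + k) (z.testBit k).toNat := by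
  funext i
  rw [Function.update_apply]
  rcases i with _ | _ | _ | i
  · rw [if_neg (by omega)]; rfl
  · rw [if_neg (by omega)]; rfl
  · rw [if_neg (by omega)]; rfl
  · simp only [inputRegs]
    split_ifs with h1 h2 h3 <;> first | rfl | omega | skip
    congr 2; omega

theorem inputRegs_self {l z : ℕ} (hz : z < 2 ^ l) (i : ℕ) : inputRegs l z l (i + 3) = 0 := by
  simp only [inputRegs]
  split_ifs with h
  · rw [Nat.testBit_lt_two_pow (hz.trans_le (Nat.pow_le_pow_right (by norm_num) h))]; rfl
  · rfl

theorem wp_input {b l z : ℕ} {arr : ℕ → ℕ} {σ : State} (hb : σ.var .base = b) (hl : σ.var .ell = l)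
    (hz : σ.var .cand = z) (hpl : σ.var .pl = 2 ^ l) (hzl : z < 2 ^ l) (hl0 : 0 < l)
    (hmem : Layout b arr (fun _ => 0) σ.mem) :
    wp inputCmd σ 0 fun τ t => t ≤ l * 15 + 28 ∧ τ.var .rb = b + 1 ∧
      Layout b arr (initial (bitString l z) (1 / 2)).reg τ.mem ∧ ∀ i < b, τ.mem i = σ.mem i := by
  rw [initial_bitString hzl]
  simp only [inputCmd, wp_op_seq, Op.code, List.length]
  generalize hσ' : Op.exec _ _ = σ'
  have hf : ∀ r ∉ [Var.rb, .tmp, .aux, .pos, .rest, .ctr], σ'.var r = σ.var r := by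
    intro r hr
    simp only [List.mem_cons, not_or] at hr
    simp [← hσ', hr]
  have hrb : σ'.var .rb = b + 1 := by simp [← hσ', hb]
  have hL : Layout b arr (inputRegs l z l) σ'.mem := by
    have : σ'.mem = Function.update (Function.update (Function.update σ.mem (b + 1 + 2 * 0) l)
        (b + 1 + 2 * 1) 1) (b + 1 + 2 * 2) 2 := by
      simp [← hσ', hb, hl]
    rw [this]
    convert ((hmem.update_reg 0 l).update_reg 1 1).update_reg 2 2 using 1
    funext i
    rcases i with _ | _ | _ | i
    · simp [inputRegs]
    · simp [inputRegs]
    · simp [inputRegs]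
    · simp [inputRegs_self hzl]
  have hi : ∀ i < b, σ'.mem i = σ.mem i := by
    intro i hi
    simp [← hσ', hb, hl]
    rw [Function.update_of_ne (by omega), Function.update_of_ne (by omega),
      Function.update_of_ne (by omega)]
  have key := wp_loop (a := .op (.add .rest .rest .rest) ;; .op (.sub .tmp .pl .rest) ;;
      .op (.subc .pos .pos 2) ;; .ifz .tmp (.op (.sub .rest .rest .pl) ;; .op (.set .aux 1) ;;
      .op (.store .pos .aux))) (x := .ctr) (n := 12) (σ := σ')
    (fun k τ => k ≤ l ∧ τ.var .rest = z % 2 ^ k * 2 ^ (l - k) ∧ τ.var .rb = b + 1 ∧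
      τ.var .pos = b + 1 + 2 * (3 + k) ∧ Layout b arr (inputRegs l z k) τ.mem ∧
      ∀ i < b, τ.mem i = σ.mem i) (by decide)
    (by simp) ?_ (k := l) (by simp [← hσ', hl]) hl0 ?_
  · refine wp_mono (wp_shift key _) ?_
    rintro τ t ⟨ht, -, -, hrb, -, hL, hi⟩
    exact ⟨by omega, hrb, hL, hi⟩
  · rintro k τ hf' ⟨hk, hr, hrb, hp, hL, hi⟩ -
    have hpl' : τ.var .pl = 2 ^ l := by
      rw [hf' _ (by decide) (by decide), hf _ (by decide), hpl]
    have hd := double_mod (u := z) (Nat.lt_of_succ_le hk)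
    have hlt := mod_mul_lt (u := z) (Nat.le_of_succ_le hk)
    rw [← hr] at hd
    have hpos : τ.var .pos - 2 = b + 1 + 2 * (3 + k) := by omega
    rw [inputRegs_pred]
    split_ifs at hd with hbit
    · simp [Op.code, hpos, hpl', hd, hrb, hbit]
      refine ⟨by omega, hL.update_reg _ _, ?_⟩
      intro i hib
      rw [Function.update_of_ne (by omega), hi i hib]
    · have : ¬ 2 ^ l ≤ z % 2 ^ k * 2 ^ (l - k) := by omega
      simp [Op.code, hpos, hpl', hd, Nat.sub_eq_zero_iff_le, this, hrb, hbit]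
      refine ⟨by omega, ?_, hi⟩
      rwa [Function.update_eq_self_iff.2]
      rw [add_comm 3 k]
      simp [inputRegs]
  · refine ⟨le_rfl, ?_, hrb, ?_, hL, hi⟩
    · simp [← hσ', hz, Nat.mod_eq_of_lt hzl]
    · simp [← hσ', hl, hb]; ring

theorem wp_simulate {b n : ℕ} {arr : ℕ → ℕ} {c : Config} {σ : State} (hrb : σ.var .rb = b + 1)
    (hb : σ.var .base = b) (hn : σ.var .tau = n) (hn0 : 0 < n) (hc : c.pc = 0)
    (hmem : Layout b arr c.reg σ.mem) :
    wp simulateCmd σ 0 fun τ t => t ≤ n * 153 + 4 ∧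
      τ.var .pc = b + 8 * ((simStep arr)^[n] c).pc ∧
      Layout b arr ((simStep arr)^[n] c).reg τ.mem ∧ ∀ i < b, τ.mem i = σ.mem i := by
  rw [simulateCmd, wp_op_seq, wp_op_seq]
  have key := wp_loop (a := stepCmd) (x := .ctr) (n := 150)
    (σ := (Op.addc .ctr .tau 0).exec ((Op.addc .pc .base 0).exec σ))
    (fun k τ => k ≤ n ∧ τ.var .pc = b + 8 * ((simStep arr)^[n - k] c).pc ∧
      Layout b arr ((simStep arr)^[n - k] c).reg τ.mem ∧ ∀ i < b, τ.mem i = σ.mem i) (by decide)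
    (by simp) ?_ (k := n) (by simp [hn]) hn0 (by simpa [hb, hc] using hmem)
  · refine wp_mono (wp_shift key _) ?_
    rintro τ t ⟨ht, -, hpc, hL, hi⟩
    exact ⟨by simp [Op.code] at ht; omega, by simpa using hpc, by simpa using hL, hi⟩
  · rintro k τ hf ⟨hk, hpc, hL, hi⟩ -
    have hs : (simStep arr)^[n - k] c = simStep arr ((simStep arr)^[n - (k + 1)] c) := by
      rw [← Function.iterate_succ_apply' (simStep arr)]; congr 1; omega
    refine wp_mono (wp_step (c := (simStep arr)^[n - (k + 1)] c) ?_ ?_ hpc hL) ?_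
    · rw [hf _ (by decide) (by decide)]; simpa using hrb
    · rw [hf _ (by decide) (by decide)]; simpa using hb
    · rintro ρ t ⟨ht, hpc', hL', hi'⟩
      rw [hs]
      exact ⟨ht, by omega, hpc', hL', fun i h => by rw [hi' i h, hi i h]⟩

theorem wp_output {b n : ℕ} {arr : ℕ → ℕ} {c : Config} {σ : State} (hrb : σ.var .rb = b + 1)
    (hpc : σ.var .pc = b + 8 * c.pc) (hn : σ.var .expo = n) (hn0 : 0 < n)
    (hmem : Layout b arr c.reg σ.mem) :
    wp outputCmd σ 0 fun τ t => t ≤ n * 4 + 13 ∧ τ.mem = σ.mem ∧ τ.var .code = arr (4 * c.pc) ∧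
      τ.var .argA = 2 ^ n * c.reg 0 ∧ τ.var .argB = c.reg 1 := by
  have h0 : σ.mem (b + 8 * c.pc) = arr (4 * c.pc) := by rw [← hmem.code]; congr 1; ring
  have h1 : σ.mem (b + 1) = c.reg 0 := by rw [← hmem.reg]
  have h2 : σ.mem (b + 3) = c.reg 1 := by rw [← hmem.reg]
  simp only [outputCmd, wp_op_seq]
  generalize hσ' : Op.exec _ _ = σ'
  have key := wp_loop (a := .op (.add .argA .argA .argA)) (x := .ctr) (n := 1) (σ := σ')
    (fun k τ => k ≤ n ∧ τ.var .argA = 2 ^ (n - k) * c.reg 0 ∧ τ.mem = σ.mem ∧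
      τ.var .code = arr (4 * c.pc) ∧ τ.var .argB = c.reg 1) (by decide)
    (by simp) ?_ (k := n) (by simp [← hσ', hn]) hn0 ?_
  · refine wp_mono (wp_shift key _) ?_
    rintro τ t ⟨ht, -, ha, hm, hc, hb⟩
    exact ⟨by simp [Op.code] at ht; omega, hm, hc, by simpa using ha, hb⟩
  · rintro k τ hf ⟨hk, ha, hm, hc, hb⟩ -
    have : n - k = (n - (k + 1)) + 1 := by omega
    simp [Op.code, ha, hm, hc, hb, this, pow_succ]
    exact ⟨by omega, by ring⟩
  · simp [← hσ', hpc, h0, h1, h2, hrb]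

/-- A run of the universal machine: the program number `u` is run on the string number `z` for `n`
steps. Cells before `b` keep their contents, and the memory from `b + s` on stays empty, which
leaves room for the next run without any need for clearing memory. -/
theorem wp_run {b m l e n u z s : ℕ} {σ : State} (hb : σ.var .base = b) (hm : σ.var .scale = m)
    (hl : σ.var .ell = l) (he : σ.var .expo = e) (hn : σ.var .tau = n)
    (hu : σ.var .prog = u) (hz : σ.var .cand = z) (hpm : σ.var .pm = 2 ^ m)
    (hpl : σ.var .pl = 2 ^ l) (hs : s = 2 ^ (n + 1) * (l + 4))
    (hum : u < 2 ^ m) (hzl : z < 2 ^ l) (hm0 : 0 < m) (hml : m ≤ l) (he0 : 0 < e) (hn0 : 0 < n)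
    (hmem : ∀ a, b ≤ a → σ.mem a = 0) {c : Config}
    (hc : c = (simStep (codeArray m u))^[n] (initial (bitString l z) (1 / 2))) :
    wp runCmd σ 0 fun τ t => t ≤ 19 * m + 15 * l + 153 * n + 4 * e + 51 ∧
      τ.var .code = codeArray m u (4 * c.pc) ∧ τ.var .argA = 2 ^ e * c.reg 0 ∧
      τ.var .argB = c.reg 1 ∧ (∀ i < b, τ.mem i = σ.mem i) ∧ ∀ a, b + s ≤ a → τ.mem a = 0 := by
  rw [runCmd, wp_seq]
  refine wp_frame (wp_mono (wp_decode hb hm hu hpm hum hm0 hmem) ?_)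
  rintro σ₁ t₁ ⟨ht₁, hL₁, hi₁⟩ hf₁
  rw [wp_seq]
  refine wp_frame (wp_mono (wp_shift (wp_input (b := b) (l := l) (z := z) ?_ ?_ ?_ ?_ hzl
    (by omega) hL₁) t₁) ?_)
  any_goals rw [hf₁ _ (by decide)]; assumption
  rintro σ₂ t₂ ⟨ht₂, hrb₂, hL₂, hi₂⟩ hf₂
  rw [wp_seq]
  refine wp_frame (wp_mono (wp_shift (wp_simulate (n := n) hrb₂ ?_ ?_ hn0 rfl hL₂) t₂) ?_)
  any_goals rw [hf₂ _ (by decide), hf₁ _ (by decide)]; assumption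
  rintro σ₃ t₃ ⟨ht₃, hpc₃, hL₃, hi₃⟩ hf₃
  rw [← hc] at hpc₃ hL₃
  refine wp_mono (wp_shift (wp_output (n := e) ?_ hpc₃ ?_ he0 hL₃) t₃) ?_
  · rw [hf₃ _ (by decide), hrb₂]
  · rw [hf₃ _ (by decide), hf₂ _ (by decide), hf₁ _ (by decide), he]
  rintro τ t ⟨ht, hm', hcode, hA, hB⟩
  refine ⟨by omega, hcode, hA, hB, fun i hi => ?_, fun a ha => ?_⟩
  · rw [hm', hi₃ i hi, hi₂ i hi, hi₁ i hi]
  · rw [hm']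
    -- the initial registers are bounded by `l + 3`, and each step at most doubles the bound
    have hbd : c.Bounded (2 ^ n * (l + 3)) := by
      rw [hc]
      refine Config.Bounded.iterate (fun i => (codeArray_le _ _ _).trans (by omega)) ?_ _
      rw [Config.Bounded, initial_bitString hzl]
      refine ⟨fun j => ?_, fun j hj => ?_⟩
      · rcases j with _ | _ | _ | j
        · simp [inputRegs]
        · simp [inputRegs]
        · simp [inputRegs]
        · have := Bool.toNat_le (z.testBit j)
          simp only [inputRegs]
          split_ifs <;> omega
      · obtain ⟨j, rfl⟩ : ∃ j', j = j' + 3 := ⟨j - 3, by omega⟩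
        simp only [inputRegs, Nat.zero_le, if_true]
        rw [Nat.testBit_lt_two_pow (hzl.trans_le (Nat.pow_le_pow_right (by norm_num) (by omega)))]
        rfl
    have h1 : 1 ≤ 2 ^ n := Nat.one_le_two_pow
    have h2 : s = 2 * (2 ^ n * (l + 3)) + 2 * 2 ^ n := by rw [hs]; ring
    have h3 : 1 * (l + 3) ≤ 2 ^ n * (l + 3) := Nat.mul_le_mul_right _ h1
    obtain ⟨i, rfl | rfl⟩ : ∃ i, a = b + 2 * i ∨ a = b + 1 + 2 * i := ⟨(a - b) / 2, by omega⟩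
    · rw [hL₃.code, codeArray_eq_zero (by omega)]
    · rw [hL₃.reg, hbd.2 _ (by omega)]

/-! ### Choosing a string that is bad for no admissible program -/

section
variable (bad : ℕ → ℕ → Prop) (thr K : ℕ)

open Classical in
/-- Each program `u` may exclude up to `thr` strings `z`, namely the first ones that are bad for it.
This is the number of strings before `z` that `u` has excluded. -/
noncomputable def used : ℕ → ℕ → ℕ
  | 0, _ => 0
  | z + 1, u => if bad u z ∧ used z u < thr then used z u + 1 else used z u

/-- The string `z` is excluded by one of the first `K` programs. -/
def Excluded (z : ℕ) : Prop := ∃ u < K, bad u z ∧ used bad thr z u < thr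

variable {bad thr K}

theorem used_le (z u : ℕ) : used bad thr z u ≤ thr := by
  induction z with
  | zero => exact Nat.zero_le _
  | succ z ih => rw [used]; split_ifs with h <;> omega

open Classical in
theorem used_le_card (z u : ℕ) : used bad thr z u ≤ ((Finset.range z).filter (bad u)).card := by
  induction z with
  | zero => exact Nat.zero_le _
  | succ z ih =>
    rw [used, Finset.range_add_one, Finset.filter_insert]
    split_ifs with h h' h'
    · rw [Finset.card_insert_of_notMem (by simp)]; omega
    · exact absurd h.1 h'
    · rw [Finset.card_insert_of_notMem (by simp)]; omega
    · exact ih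

/-- Since each of the `K` programs excludes at most `thr` strings, some string survives. -/
theorem exists_not_excluded {N : ℕ} (h : K * thr < N) : ∃ z < N, ¬ Excluded bad thr K z := by
  by_contra! hN
  -- each string before `N` uses up one unit of the budget of some program
  have key : ∀ z ≤ N, z ≤ ∑ u ∈ Finset.range K, used bad thr z u := by
    intro z
    induction z with
    | zero => exact fun _ => Nat.zero_le _
    | succ z ih =>
      intro hz
      obtain ⟨u, hu, hbad⟩ := hN z (by omega)
      refine (Nat.succ_le_succ (ih (by omega))).trans (Nat.succ_le_of_lt ?_)
      refine Finset.sum_lt_sum (fun v _ => ?_) ⟨u, Finset.mem_range.2 hu, ?_⟩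
      · rw [used]; split_ifs <;> omega
      · rw [used, if_pos hbad]; omega
  have := (key N le_rfl).trans (Finset.sum_le_sum fun u _ => used_le N u)
  simp at this
  omega

open Classical in
/-- A string that is not excluded is good for all programs with at most `thr` bad strings. -/
theorem not_bad_of_not_excluded {N u z : ℕ} (hu : u < K)
    (hcard : ((Finset.range N).filter (bad u)).card ≤ thr) (hz : z < N)
    (h : ¬ Excluded bad thr K z) : ¬ bad u z := by
  intro hbad
  refine h ⟨u, hu, hbad, (used_le_card z u).trans_lt (lt_of_lt_of_le ?_ hcard)⟩
  refine Finset.card_lt_card ⟨fun i hi => ?_, fun hsub => ?_⟩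
  · simp only [Finset.mem_filter, Finset.mem_range] at hi ⊢
    exact ⟨by omega, hi.2⟩
  · have := hsub (Finset.mem_filter.2 ⟨Finset.mem_range.2 hz, hbad⟩)
    simp at this

end

/-- The sizes that govern the search: the input length `s`, the number `m` of bits of a program,
the exponent `e` of the threshold, the length `l` of the candidate strings, and the number `n` of
steps for which programs are simulated. -/
structure Sizes : Type where
  (s m e l n : ℕ)
  m_pos : 0 < m
  e_pos : 0 < e
  n_pos : 0 < n
  l_eq : l = e + m + 2

namespace Sizes
variable (P : Sizes)

/-- The result of running the program number `u` on the string number `z`. -/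
def result (u z : ℕ) : Config :=
  (simStep (codeArray P.m u))^[P.n] (initial (bitString P.l z) (1 / 2))

/-- The program number `u` halts in time on the string number `z`, with an output that is
greater than `2 ^ (-e)`. The denominator of the output has to be positive. -/
def Bad (u z : ℕ) : Prop :=
  codeArray P.m u (4 * (P.result u z).pc) = 0 ∧ 0 < (P.result u z).reg 1 ∧
    (P.result u z).reg 1 < 2 ^ P.e * (P.result u z).reg 0

/-- The string number `z` is excluded by some program. -/
def Out (z : ℕ) : Prop := Excluded P.Bad (2 ^ (P.e + 1)) (2 ^ P.m) z

theorem exists_not_out : ∃ z < 2 ^ P.l, ¬ P.Out z := by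
  refine exists_not_excluded ?_
  rw [← pow_add, P.l_eq]
  exact Nat.pow_lt_pow_right (by norm_num) (by omega)

open Classical in
/-- The first string that is not excluded. -/
noncomputable def choice : ℕ := Nat.find (P.exists_not_out.imp fun _ h => h.2)

theorem choice_not_out : ¬ P.Out P.choice := by
  classical exact Nat.find_spec (P.exists_not_out.imp fun _ h => h.2)

theorem out_of_lt {z : ℕ} (h : z < P.choice) : P.Out z := by
  classical exact not_not.1 (Nat.find_min (P.exists_not_out.imp fun _ h => h.2) h)

theorem choice_lt : P.choice < 2 ^ P.l := by
  obtain ⟨z, hz, h⟩ := P.exists_not_out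
  by_contra! h'
  exact h (P.out_of_lt (hz.trans_le h'))

/-- The variables hold the given sizes and the numbers derived from them. -/
structure Stored (σ : State) : Prop where
  len : σ.var .len = P.s
  scale : σ.var .scale = P.m
  expo : σ.var .expo = P.e
  ell : σ.var .ell = P.l
  tau : σ.var .tau = P.n
  pm : σ.var .pm = 2 ^ P.m
  thr : σ.var .thr = 2 ^ (P.e + 1)
  pl : σ.var .pl = 2 ^ P.l
  span : σ.var .span = 2 ^ (P.n + 1) * (P.l + 4)

variable {P}

theorem Stored.congr {σ τ : State} (h : P.Stored σ)
    (hf : ∀ r ∈ [Var.len, .scale, .expo, .ell, .tau, .pm, .thr, .pl, .span], τ.var r = σ.var r) :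
    P.Stored τ where
  len := by rw [hf _ (by decide), h.len]
  scale := by rw [hf _ (by decide), h.scale]
  expo := by rw [hf _ (by decide), h.expo]
  ell := by rw [hf _ (by decide), h.ell]
  tau := by rw [hf _ (by decide), h.tau]
  pm := by rw [hf _ (by decide), h.pm]
  thr := by rw [hf _ (by decide), h.thr]
  pl := by rw [hf _ (by decide), h.pl]
  span := by rw [hf _ (by decide), h.span]

theorem Stored.of_frame {c : Cmd} {σ τ : State} (h : P.Stored σ)
    (hf : ∀ r ∉ c.mods, τ.var r = σ.var r)
    (hc : ∀ r ∈ [Var.len, .scale, .expo, .ell, .tau, .pm, .thr, .pl, .span], r ∉ c.mods) :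
    P.Stored τ :=
  h.congr fun r hr => hf r (hc r hr)

end Sizes

section
open Op Var

/-- If the output of the last run is bad, and the program may still exclude strings, then exclude
the current string. In any case, go on to the next program, and move `base` to fresh memory. The
variable `tmp` adds up numbers which are zero if the conditions for an exclusion are fulfilled. -/
def verdictCmd : Cmd :=
  .op (add pos len prog) ;; .op (load aux pos) ;;
  .op (csub tmp 1 argB) ;; .op (add tmp tmp .code) ;;
  .op (sub val argA argB) ;; .op (csub val 1 val) ;; .op (add tmp tmp val) ;;
  .op (sub val thr aux) ;; .op (csub val 1 val) ;; .op (add tmp tmp val) ;;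
  .ifz tmp (.op (addc aux aux 1) ;; .op (store pos aux) ;; .op (set dead 1)) ;;
  .op (add base base span) ;; .op (addc prog prog 1)

/-- Run all programs on the current string, and set `dead` if one of them excludes it. -/
def testCmd : Cmd :=
  .op (set dead 0) ;; .op (set prog 0) ;; .op (addc cnt pm 0) ;; .loop cnt (runCmd ;; verdictCmd)

/-- Find the first string that is not excluded. The numbers of strings that the programs have
excluded so far are kept in the memory between the input and `base`. -/
def searchCmd : Cmd :=
  .op (set cand 0) ;; .op (add base len pm) ;; .dowhile (testCmd ;; .op (addc cand cand 1)) dead ;;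
  .op (subc cand cand 1)

end

namespace Sizes
variable {P : Sizes}

/-- A bound on the time for one run and its evaluation. -/
def runTime (P : Sizes) : ℕ := 19 * P.m + 15 * P.l + 153 * P.n + 4 * P.e + 76

open Classical in
theorem wp_try {b u z : ℕ} {σ : State} (hσ : P.Stored σ) (hb : σ.var .base = b)
    (hu : σ.var .prog = u) (hz : σ.var .cand = z) (hum : u < 2 ^ P.m) (hzl : z < 2 ^ P.l)
    (hsb : P.s + 2 ^ P.m ≤ b) (hmem : ∀ a, b ≤ a → σ.mem a = 0) :
    wp (runCmd ;; verdictCmd) σ 0 fun τ t => t ≤ P.runTime ∧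
      (∃ b', τ.var .base = b' ∧ P.s + 2 ^ P.m ≤ b' ∧ ∀ a, b' ≤ a → τ.mem a = 0) ∧
      τ.var .prog = u + 1 ∧
      (∀ i < b, i ≠ P.s + u → τ.mem i = σ.mem i) ∧
      τ.mem (P.s + u) = (if P.Bad u z ∧ σ.mem (P.s + u) < 2 ^ (P.e + 1) then σ.mem (P.s + u) + 1
        else σ.mem (P.s + u)) ∧
      τ.var .dead = if P.Bad u z ∧ σ.mem (P.s + u) < 2 ^ (P.e + 1) then 1 else σ.var .dead := by
  rw [wp_seq]
  refine wp_frame (wp_mono (wp_run hb hσ.scale hσ.ell hσ.expo hσ.tau hu hz hσ.pm hσ.pl rfl hum hzl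
    P.m_pos (by have := P.l_eq; omega) P.e_pos P.n_pos hmem (c := P.result u z) rfl) ?_)
  rintro τ t ⟨ht, hc, hA, hB, hi, h0⟩ hf
  have hst : P.Stored τ := hσ.of_frame hf (by decide)
  have hu' : τ.var .prog = u := by rw [hf _ (by decide), hu]
  have hb' : τ.var .base = b := by rw [hf _ (by decide), hb]
  have hd' : τ.var .dead = σ.var .dead := by rw [hf _ (by decide)]
  have hlt : P.s + u < b := by omega
  have hm' := hi _ hlt
  rw [Bad]
  generalize P.result u z = c at *
  generalize codeArray P.m u (4 * c.pc) = o at *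
  generalize c.reg 1 = x at *
  generalize 2 ^ P.e * c.reg 0 = y at *
  have hcond : (1 - x + o + (1 - (y - x)) + (1 - (2 ^ (P.e + 1) - σ.mem (P.s + u))) = 0) ↔
      (o = 0 ∧ 0 < x ∧ x < y) ∧ σ.mem (P.s + u) < 2 ^ (P.e + 1) := by omega
  rw [verdictCmd]
  simp only [wp_op_seq, wp_ifz_seq, Op.add_var, Op.load_var, Op.csub_var, Op.sub_var, Op.add_mem,
    Op.code, List.length, reduceCtorEq, if_true, if_false, hst.len, hst.thr, hu', hA, hB, hc, hm']
  by_cases h : (o = 0 ∧ 0 < x ∧ x < y) ∧ σ.mem (P.s + u) < 2 ^ (P.e + 1)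
  · rw [if_pos (hcond.2 h), if_pos h, if_pos h]
    simp only [wp_seq_assoc, wp_op_seq, wp_op, Op.add_var, Op.load_var, Op.csub_var,
      Op.sub_var, Op.set_var, Op.addc_var, Op.store_var, Op.add_mem, Op.load_mem, Op.csub_mem,
      Op.sub_mem, Op.set_mem, Op.addc_mem, Op.store_mem, Op.code, List.length, reduceCtorEq,
      if_true, if_false, hst.len, hst.span, hu', hb', hm']
    refine ⟨by rw [runTime]; omega, ⟨_, rfl, by omega, fun a ha => ?_⟩, trivial,
      fun i hib hne => ?_, ?_, trivial⟩
    · rw [Function.update_of_ne (by omega), h0 _ ha]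
    · rw [Function.update_of_ne hne, hi i hib]
    · simp
  · rw [if_neg (hcond.not.2 h), if_neg h, if_neg h]
    simp only [wp_op, Op.add_var, Op.load_var, Op.csub_var, Op.sub_var, Op.addc_var,
      Op.add_mem, Op.load_mem, Op.csub_mem, Op.sub_mem, Op.addc_mem, Op.code, List.length,
      reduceCtorEq, if_true, if_false, hst.span, hu', hb', hd', hm']
    exact ⟨by rw [runTime]; omega, ⟨_, rfl, by omega, h0⟩, trivial, fun i hib _ => hi i hib,
      trivial, trivial⟩

/-- The memory between the input and `base` holds the numbers of strings excluded so far, and from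
`base` on it is empty. -/
def Table (P : Sizes) (f : ℕ → ℕ) (σ : State) : Prop :=
  (∀ u < 2 ^ P.m, σ.mem (P.s + u) = f u) ∧
    ∃ b, σ.var .base = b ∧ P.s + 2 ^ P.m ≤ b ∧ ∀ a, b ≤ a → σ.mem a = 0

open Classical in
theorem wp_test {z : ℕ} {σ : State} (hσ : P.Stored σ) (hz : σ.var .cand = z) (hzl : z < 2 ^ P.l)
    (htab : P.Table (used P.Bad (2 ^ (P.e + 1)) z) σ) :
    wp testCmd σ 0 fun τ t => t ≤ 2 ^ P.m * (P.runTime + 3) + 4 ∧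
      P.Table (used P.Bad (2 ^ (P.e + 1)) (z + 1)) τ ∧ (0 < τ.var .dead ↔ P.Out z) := by
  simp only [testCmd, wp_op_seq]
  generalize hσ' : Op.exec _ _ = σ'
  have hst : P.Stored σ' := hσ.congr (by simp [← hσ'])
  have hz' : σ'.var .cand = z := by simp [← hσ', hz]
  have key := wp_loop (a := runCmd ;; verdictCmd) (x := .cnt) (n := P.runTime) (σ := σ')
    (fun k τ => k ≤ 2 ^ P.m ∧ τ.var .prog = 2 ^ P.m - k ∧
      P.Table (fun u => used P.Bad (2 ^ (P.e + 1)) (if u < 2 ^ P.m - k then z + 1 else z) u) τ ∧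
      (0 < τ.var .dead ↔
        ∃ u < 2 ^ P.m - k, P.Bad u z ∧ used P.Bad (2 ^ (P.e + 1)) z u < 2 ^ (P.e + 1)))
    (by decide) (by simp [Table]) ?_ (k := 2 ^ P.m) (by simp [← hσ', hσ.pm]) (by positivity) ?_
  · refine wp_mono (wp_shift key _) ?_
    rintro τ t ⟨ht, -, -, htab, hdead⟩
    refine ⟨by simp [Op.code] at ht; omega, ⟨fun u hu => ?_, htab.2⟩, hdead⟩
    rw [htab.1 u hu]
    beta_reduce
    rw [if_pos (by omega)]
  · rintro k τ hf ⟨hk, hprog, ⟨htab, b, hb, hsb, hmem⟩, hdead⟩ -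
    have hst' : P.Stored τ := hst.congr (by
      intro r hr
      refine hf r ?_ ?_ <;> revert r <;> decide)
    have hum : 2 ^ P.m - (k + 1) < 2 ^ P.m := by omega
    have hcand : τ.var .cand = z := by rw [hf _ (by decide) (by decide), hz']
    refine wp_mono (wp_try hst' hb hprog hcand hum hzl hsb hmem) ?_
    have hsucc : 2 ^ P.m - k = 2 ^ P.m - (k + 1) + 1 := by clear * - hk; omega
    rw [hsucc]
    generalize 2 ^ P.m - (k + 1) = u at *
    have hu0 : τ.mem (P.s + u) = used P.Bad (2 ^ (P.e + 1)) z u := by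
      rw [htab u hum]
      beta_reduce
      rw [if_neg (lt_irrefl u)]
    rw [hu0]
    rintro ρ t ⟨ht, hbase, hprog', hi, hused, hd⟩
    refine ⟨ht, by omega, hprog', ⟨fun v hv => ?_, hbase⟩, ?_⟩
    · by_cases hvu : v = u
      · subst hvu
        rw [hused]
        beta_reduce
        rw [if_pos (Nat.lt_succ_self v), used]
      · rw [hi _ (by omega) (by omega), htab v hv]
        beta_reduce
        congr 1
        split_ifs <;> first | rfl | omega
    · rw [hd]
      split_ifs with h
      · exact ⟨fun _ => ⟨u, by omega, h⟩, fun _ => by norm_num⟩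
      · rw [hdead]
        constructor
        · rintro ⟨v, hv, hbad⟩; exact ⟨v, by omega, hbad⟩
        · rintro ⟨v, hv, hbad⟩
          refine ⟨v, ?_, hbad⟩
          by_contra hvu
          obtain rfl : v = u := by omega
          exact h hbad
  · refine ⟨le_rfl, by simp [← hσ'], ⟨fun u hu => ?_, ?_⟩, by simp [← hσ']⟩
    · beta_reduce
      rw [if_neg (by omega), ← htab.1 u hu, ← hσ']
      simp
    · simpa [← hσ'] using htab.2

/-- A bound on the time for the search. -/
def searchTime (P : Sizes) : ℕ := 2 ^ P.l * (2 ^ P.m * (P.runTime + 3) + 7) + 4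

/-- The search succeeds, because some candidate string is not excluded. -/
theorem wp_search {σ : State} (hσ : P.Stored σ) (hmem : ∀ a, P.s ≤ a → σ.mem a = 0) :
    wp searchCmd σ 0 fun τ t => t ≤ P.searchTime ∧ τ.var .cand = P.choice := by
  simp only [searchCmd, wp_op_seq]
  generalize hσ' : Op.exec _ _ = σ'
  have hst : P.Stored σ' := hσ.congr (by simp [← hσ'])
  rw [wp_seq]
  have key := wp_dowhile (a := testCmd ;; .op (.addc .cand .cand 1)) (x := .dead)
    (n := 2 ^ P.m * (P.runTime + 3) + 6) (σ := σ') (k := P.choice)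
    (fun k τ => k ≤ P.choice ∧ τ.var .cand = P.choice - k ∧
      P.Table (used P.Bad (2 ^ (P.e + 1)) (P.choice - k)) τ)
    (fun τ => τ.var .cand = P.choice + 1) ?_ ?_
  · refine wp_mono (wp_shift key _) ?_
    rintro τ t ⟨ht, hc⟩
    have hle : (P.choice + 1) * _ ≤ _ :=
      Nat.mul_le_mul_right (2 ^ P.m * (P.runTime + 3) + 7) P.choice_lt
    simp only [wp_op, Op.subc_var, hc, if_true, Op.code, List.length, searchTime]
    replace ht : t ≤ 2 + (P.choice + 1) * (2 ^ P.m * (P.runTime + 3) + 7) := ht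
    exact ⟨by omega, by omega⟩
  · rintro k τ hf ⟨hk, hcand, htab⟩
    have hst' : P.Stored τ := hst.congr (by
      intro r hr
      refine hf r ?_; revert r; decide)
    have hlt := P.choice_lt
    rw [wp_seq]
    refine wp_frame (wp_mono (wp_test hst' hcand (by omega) htab) ?_)
    rintro ρ t ⟨ht, htab', hdead⟩ hf'
    have hcand' : ρ.var .cand = P.choice - k := by rw [hf' _ (by decide), hcand]
    simp only [wp_op, Op.addc_var, if_true, Op.code, List.length, hcand', reduceCtorEq, if_false]
    refine ⟨by omega, ?_⟩
    rcases k with _ | k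
    · left
      have := (not_congr hdead).2 (by simpa using P.choice_not_out)
      exact ⟨by omega, by omega⟩
    · right
      refine ⟨hdead.2 (P.out_of_lt (by omega)), k, rfl, by omega, by omega, ?_⟩
      rw [show P.choice - k = P.choice - (k + 1) + 1 by omega]
      exact htab'
  · refine ⟨le_rfl, by simp [← hσ'], fun u hu => ?_, _, rfl, ?_, fun a ha => ?_⟩
    · rw [← hσ']
      simpa [used] using hmem _ (by omega)
    · simp [← hσ', hσ.len, hσ.pm]
    · replace ha : σ'.var .base ≤ a := ha
      have hb : σ'.var .base = P.s + 2 ^ P.m := by simp [← hσ', hσ.len, hσ.pm]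
      have hsa : P.s ≤ a := (Nat.le_add_right _ _).trans (hb ▸ ha)
      rw [← hσ']
      exact hmem a hsa

end Sizes

/-! ### Reading the input -/

/-- The number whose lowest `n` binary digits are given by `f`. -/
def bitSum (f : ℕ → Bool) (n : ℕ) : ℕ := ∑ i ∈ Finset.range n, (f i).toNat * 2 ^ i

theorem bitSum_succ (f : ℕ → Bool) (n : ℕ) :
    bitSum f (n + 1) = bitSum f n + if f n then 2 ^ n else 0 := by
  rw [bitSum, Finset.sum_range_succ, ← bitSum]
  cases f n <;> simp

theorem bitSum_lt (f : ℕ → Bool) (n : ℕ) : bitSum f n < 2 ^ n := by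
  induction n with
  | zero => simp [bitSum]
  | succ n ih => rw [bitSum_succ, pow_succ]; split_ifs <;> omega

theorem testBit_bitSum (f : ℕ → Bool) (n i : ℕ) :
    (bitSum f n).testBit i = (decide (i < n) && f i) := by
  induction n with
  | zero => simp [bitSum]
  | succ n ih =>
    have hlt := bitSum_lt f n
    rw [bitSum_succ]
    rcases lt_trichotomy i n with h | rfl | h
    · have h1 : i < n + 1 := by omega
      split_ifs
      · rw [add_comm, Nat.testBit_two_pow_add_gt h, ih]; simp [h, h1]
      · rw [add_zero, ih]; simp [h, h1]
    · split_ifs with hf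
      · rw [add_comm, Nat.testBit_two_pow_add_eq, ih]; simp [hf]
      · rw [add_zero, ih]; simp [hf]
    · have h1 : ¬ i < n + 1 := by omega
      rw [Nat.testBit_lt_two_pow]
      · simp [h1]
      · have : 2 ^ (n + 1) ≤ 2 ^ i := Nat.pow_le_pow_right (by norm_num) h
        rw [pow_succ] at this
        split_ifs <;> omega

section
open Op Var

/-- Append the bits held by the variables in the list to the number `word`. No register is free for
conditional addition yet, so `pw` is added first and subtracted again if the bit is zero. -/
def readVars : List Var → Cmd
  | [] => .skip
  | x :: l => .op (add word word pw) ;; .ifz x (.op (sub word word pw)) ;; .op (add pw pw pw) ;;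
    readVars l

/-- The variables whose registers hold bits of the input, except for `pw`. -/
def inputVars : List Var :=
  [scale, expo, ell, pm, thr, pl, tau, span, base, cand, prog, dead, cnt, ctr, rest, pos, tmp, aux,
    rb, pc, .code, argA, argB, argC, next, dest, val, valB]

/-- Combine the bits of the input into the number `word`. The bits in the registers that belong to
variables come first, so that these registers become available. -/
def readCmd : Cmd :=
  .op (set word 0) ;; .op (add word word pw) ;; .op (set pw 2) ;; readVars inputVars ;;
  .op (set pos 0) ;; .op (addc ctr len 1) ;;
  .loop ctr (.op (load tmp pos) ;; .op (add word word pw) ;; .ifz tmp (.op (sub word word pw)) ;;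
    .op (addc pos pos 1) ;; .op (add pw pw pw))

end

theorem idx_inputVars : ∀ j : Fin inputVars.length, (inputVars.get j).idx = 1 + j + 3 := by decide

theorem wp_readVars {f : ℕ → Bool} {l : List Var} (hw : Var.word ∉ l) (hp : Var.pw ∉ l) {n : ℕ}
    {σ : State} (hword : σ.var .word = bitSum f n) (hpw : σ.var .pw = 2 ^ n)
    (hl : ∀ j (h : j < l.length), σ.var l[j] = (f (n + j)).toNat) :
    wp (readVars l) σ 0 fun τ t => t ≤ 4 * l.length ∧ τ.var .word = bitSum f (n + l.length) ∧
      τ.var .pw = 2 ^ (n + l.length) ∧ τ.mem = σ.mem ∧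
      ∀ r, r ≠ .word → r ≠ .pw → τ.var r = σ.var r := by
  induction l generalizing n σ with
  | nil => simp [readVars, hword, hpw]
  | cons x l ih =>
    simp only [List.mem_cons, not_or] at hw hp
    have hx : σ.var x = (f n).toNat := hl 0 (by simp)
    have key : ∀ (σ' : State) (t : ℕ), t ≤ 4 → σ'.var .word = bitSum f (n + 1) →
        σ'.var .pw = 2 ^ (n + 1) → σ'.mem = σ.mem →
        (∀ r, r ≠ .word → r ≠ .pw → σ'.var r = σ.var r) →
        wp (readVars l) σ' t fun τ t => t ≤ 4 * (l.length + 1) ∧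
          τ.var .word = bitSum f (n + (l.length + 1)) ∧ τ.var .pw = 2 ^ (n + (l.length + 1)) ∧
          τ.mem = σ.mem ∧ ∀ r, r ≠ .word → r ≠ .pw → τ.var r = σ.var r := by
      intro σ' t ht h1 h2 h3 h4
      refine wp_mono (wp_shift (ih hw.2 hp.2 h1 h2 fun j hj => ?_) t) ?_
      · rw [h4]
        · have := hl (j + 1) (by simpa using hj)
          rw [add_assoc, add_comm 1 j]
          exact this
        · exact fun h => hw.2 (h ▸ List.getElem_mem hj)
        · exact fun h => hp.2 (h ▸ List.getElem_mem hj)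
      · rintro τ t' ⟨ht', h1', h2', h3', h4'⟩
        rw [add_comm l.length 1, ← add_assoc n]
        exact ⟨by omega, h1', h2', h3'.trans h3, fun r hr hr' => (h4' r hr hr').trans (h4 r hr hr')⟩
    rw [List.length_cons]
    simp only [readVars, wp_op_seq, wp_ifz_seq, Op.add_var, if_neg (Ne.symm hw.1), hx]
    cases hfn : f n
    · simp only [Bool.toNat_false, if_true]
      refine key _ _ (by simp [Op.code]) (by simp [hword, hpw, bitSum_succ, hfn])
        (by simp [hpw, pow_succ, mul_two]) (by simp) fun r hr hr' => by simp [hr, hr']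
    · simp only [Bool.toNat_true, one_ne_zero, if_false]
      refine key _ _ (by simp [Op.code]) (by simp [hword, hpw, bitSum_succ, hfn])
        (by simp [hpw, pow_succ, mul_two]) (by simp) fun r hr hr' => by simp [hr, hr']

theorem wp_read {f : ℕ → Bool} {s : ℕ} {σ : State} (hs : σ.var .len = s)
    (hpw : σ.var .pw = (f 0).toNat)
    (hvar : ∀ j (h : j < inputVars.length), σ.var inputVars[j] = (f (1 + j)).toNat)
    (hmem : ∀ a, σ.mem a = (f (29 + a)).toNat) :
    wp readCmd σ 0 fun τ t => t ≤ 12 * s + 150 ∧ τ.var .word = bitSum f (29 + (s + 1)) ∧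
      τ.mem = σ.mem := by
  simp only [readCmd, wp_op_seq]
  generalize hσ' : Op.exec _ _ = σ'
  have hσm : σ'.mem = σ.mem := by simp [← hσ']
  have hv := wp_readVars (f := f) (l := inputVars) (by decide) (by decide) (n := 1) (σ := σ')
    (by cases h : f 0 <;> simp [← hσ', hpw, bitSum, h]) (by simp [← hσ']) (fun j hj => by
      have h1 : ∀ x ∈ inputVars, x ≠ .pw ∧ x ≠ .word := by decide
      have h2 := h1 _ (List.getElem_mem hj)
      rw [← hvar j hj, ← hσ']
      simp [h2.1, h2.2])
  rw [wp_seq]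
  refine wp_mono (wp_shift hv _) ?_
  rintro σ₁ t₁ ⟨ht₁, hw₁, hp₁, hm₁, hf₁⟩
  simp only [wp_op_seq]
  have key := wp_loop (a := .op (.load .tmp .pos) ;; .op (.add .word .word .pw) ;;
      .ifz .tmp (.op (.sub .word .word .pw)) ;; .op (.addc .pos .pos 1) ;; .op (.add .pw .pw .pw))
    (x := .ctr) (n := 9) (σ := (Op.addc .ctr .len 1).exec ((Op.set .pos 0).exec σ₁))
    (fun k τ => ∃ j, j + k = s + 1 ∧ τ.var .word = bitSum f (29 + j) ∧ τ.var .pw = 2 ^ (29 + j) ∧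
      τ.var .pos = j ∧ τ.mem = σ.mem) (by decide) (by simp) ?_ (k := s + 1) ?_ (by omega) ?_
  · refine wp_mono (wp_shift key _) ?_
    rintro τ t ⟨ht, j, hj, hw, -, -, hm⟩
    obtain rfl : j = s + 1 := by omega
    refine ⟨?_, hw, hm⟩
    simp only [Op.code, inputVars, List.length] at ht ht₁
    omega
  · rintro k τ - ⟨j, hj, hw, hp, hpos, hm⟩ -
    have hb : τ.mem j = (f (29 + j)).toNat := by rw [hm, hmem]
    cases hf : f (29 + j)
    · simp [Op.code, hw, hp, hpos, hb, hf, hm]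
      exact ⟨by omega, by simp [← add_assoc, bitSum_succ, hf], by ring⟩
    · simp [Op.code, hw, hp, hpos, hb, hf, hm]
      exact ⟨by omega, by simp [← add_assoc, bitSum_succ, hf], by ring⟩
  · simp [hf₁, ← hσ', hs]
  · exact ⟨0, by omega, by simpa [inputVars] using hw₁, by simpa [inputVars] using hp₁, by simp,
      by simp [hm₁, hσm]⟩

/-! ### Computing the sizes -/

/-- Double `x`, `k` times. -/
def dblCmd (x : Var) : ℕ → Cmd
  | 0 => .skip
  | k + 1 => .op (.add x x x) ;; dblCmd x k

/-- The effect of `dblCmd`. -/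
def dbl (x : Var) (k : ℕ) (σ : State) : State :=
  ⟨Function.update σ.var x (2 ^ k * σ.var x), σ.mem⟩

@[simp] theorem dbl_var (x r : Var) (k : ℕ) (σ : State) :
    (dbl x k σ).var r = if r = x then 2 ^ k * σ.var x else σ.var r := by
  simp [dbl, Function.update_apply]

@[simp] theorem dbl_mem (x : Var) (k : ℕ) (σ : State) : (dbl x k σ).mem = σ.mem := rfl

@[simp] theorem wp_dbl {x k σ t Q} : wp (dblCmd x k) σ t Q ↔ Q (dbl x k σ) (t + k) := by
  induction k generalizing σ t with
  | zero => simp [dblCmd, dbl]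
  | succ k ih =>
    rw [dblCmd, wp_op_seq, ih]
    have h1 : dbl x k ((Op.add x x x).exec σ) = dbl x (k + 1) σ := by
      simp only [dbl, Op.exec, Function.update_self, Function.update_idem, pow_succ]
      congr 2; ring
    have h2 : t + (Op.add x x x).code.length + k = t + (k + 1) := by simp [Op.code]; ring
    rw [h1, h2]

@[simp] theorem wp_dbl_seq {x k c σ t Q} :
    wp (dblCmd x k ;; c) σ t Q ↔ wp c (dbl x k σ) (t + k) Q := by
  rw [wp_seq, wp_dbl]

section
open Op Var

/-- One more bit for the programs. -/
def growCmd (A B C : ℕ) : Cmd :=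
  dblCmd pw B ;; dblCmd pm 1 ;; dblCmd thr A ;; dblCmd pl (A + 1) ;; dblCmd tau C ;;
  .op (addc scale scale 1) ;; .op (addc expo expo A) ;; .op (addc tmp len 1) ;; .op (sub tmp tmp pw)

/-- Compute the sizes. The loop increases the number `scale` of bits of a program until
`pw = 2 ^ (B * scale)` exceeds the input length. -/
def sizesCmd (A B C : ℕ) : Cmd :=
  .op (set pw 1) ;; .op (set scale 0) ;; .op (set expo 0) ;; .op (set pm 1) ;; .op (set thr 2) ;;
  .op (set pl 4) ;; .op (set tau 1) ;; .dowhile (growCmd A B C) tmp ;;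
  .op (add ell expo scale) ;; .op (addc ell ell 2) ;; .op (addc span ell 4) ;;
  .op (addc ctr tau 1) ;; .loop ctr (.op (add span span span))

/-- Compare the input with the chosen string, followed by zeros, or with the zero string if the
chosen string is longer than the input. The result is the output `0 / 1` or `1 / 1`. -/
def compareCmd : Cmd :=
  .op (sub tmp ell len) ;; .op (csub tmp 1 tmp) ;; .ifz tmp (.op (set cand 0)) ;;
  .op (sub tmp word cand) ;; .op (sub aux cand word) ;; .op (add tmp tmp aux) ;;
  .op (csub len 1 tmp) ;; .op (set word 1)

/-- The program of the estimator. -/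
def estimatorCmd (A B C : ℕ) : Cmd := readCmd ;; sizesCmd A B C ;; searchCmd ;; compareCmd

end

/-- The sizes for inputs of length `s`. The number `m` of bits of a program is the least positive
number with `s < 2 ^ (B * m)`, so that `e` and `log n` are about `A / B` and `C / B` times `log s`,
up to an additive constant. -/
def sizes (A B C : ℕ) (hA : 0 < A) (s : ℕ) : Sizes where
  s := s
  m := Nat.log (2 ^ B) s + 1
  e := A * (Nat.log (2 ^ B) s + 1)
  l := A * (Nat.log (2 ^ B) s + 1) + (Nat.log (2 ^ B) s + 1) + 2
  n := 2 ^ (C * (Nat.log (2 ^ B) s + 1))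
  m_pos := by omega
  e_pos := by positivity
  n_pos := by positivity
  l_eq := rfl

theorem wp_sizes {A B C s : ℕ} {hA : 0 < A} (hB : 0 < B) {σ : State} (hs : σ.var .len = s) :
    wp (sizesCmd A B C) σ 0 fun τ t =>
      t ≤ (sizes A B C hA s).m * (2 * A + B + C + 10) + 4 * (sizes A B C hA s).n + 25 ∧
      (sizes A B C hA s).Stored τ ∧ τ.mem = σ.mem ∧ τ.var .word = σ.var .word := by
  have hm : (sizes A B C hA s).m = Nat.log (2 ^ B) s + 1 := rfl
  have he : (sizes A B C hA s).e = A * (sizes A B C hA s).m := rfl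
  have hl : (sizes A B C hA s).l = A * (sizes A B C hA s).m + (sizes A B C hA s).m + 2 := rfl
  have hn : (sizes A B C hA s).n = 2 ^ (C * (sizes A B C hA s).m) := rfl
  have hsP : (sizes A B C hA s).s = s := rfl
  have hm0 := (sizes A B C hA s).m_pos
  have hn0 := (sizes A B C hA s).n_pos
  have hlog : ∀ j, 2 ^ (B * (j + 1)) ≤ s ↔ j + 1 < (sizes A B C hA s).m := by
    intro j
    have h1 : 1 < 2 ^ B := Nat.one_lt_two_pow (by omega)
    rw [hm, Nat.lt_succ_iff, pow_mul]
    rcases Nat.eq_zero_or_pos s with rfl | h0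
    · simp
    · rw [Nat.le_log_iff_pow_le h1 (by omega)]
  generalize sizes A B C hA s = P at *
  simp only [sizesCmd, wp_op_seq]
  generalize hσ' : Op.exec _ _ = σ'
  rw [wp_seq]
  have key := wp_dowhile (a := growCmd A B C) (x := .tmp) (n := 2 * A + B + C + 9) (σ := σ')
    (k := P.m - 1)
    (fun k τ => ∃ j, j + k + 1 = P.m ∧ τ.var .pw = 2 ^ (B * j) ∧ τ.var .scale = j ∧
      τ.var .expo = A * j ∧ τ.var .pm = 2 ^ j ∧ τ.var .thr = 2 ^ (A * j + 1) ∧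
      τ.var .pl = 2 ^ (A * j + j + 2) ∧ τ.var .tau = 2 ^ (C * j) ∧ τ.var .len = s ∧
      τ.var .word = σ.var .word ∧ τ.mem = σ.mem)
    (fun τ => τ.var .scale = P.m ∧ τ.var .expo = P.e ∧ τ.var .pm = 2 ^ P.m ∧
      τ.var .thr = 2 ^ (P.e + 1) ∧ τ.var .pl = 2 ^ P.l ∧ τ.var .tau = P.n ∧ τ.var .len = s ∧
      τ.var .word = σ.var .word ∧ τ.mem = σ.mem) ?_ ?_
  · refine wp_mono (wp_shift key _) ?_
    rintro σ₁ t₁ ⟨ht₁, h1, h2, h3, h4, h5, h6, h7, h8, h9⟩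
    rw [Nat.sub_add_cancel hm0] at ht₁
    simp only [wp_op_seq]
    generalize hσ₂ : Op.exec _ _ = σ₂
    have key₂ := wp_loop (a := .op (.add .span .span .span)) (x := .ctr) (n := 1) (σ := σ₂)
      (fun k τ => ∃ j, j + k = P.n + 1 ∧ τ.var .span = 2 ^ j * (P.l + 4) ∧ τ.mem = σ₂.mem)
      (by decide) (by simp) ?_ (k := P.n + 1) (by simp [← hσ₂, h6]) (by omega) ?_
    · refine wp_frame (wp_mono (wp_shift key₂ _) ?_)
      rintro τ t ⟨ht, j, hj, hspan, hmem⟩ hf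
      obtain rfl : j = P.n + 1 := by omega
      have hr : ∀ r ∉ [Var.ell, .span, .ctr], τ.var r = σ₁.var r := by
        intro r hr
        simp only [List.mem_cons, not_or] at hr
        rw [hf r (by simp [Cmd.loop, Cmd.mods, Op.mods, hr]), ← hσ₂]
        simp [hr]
      refine ⟨?_, ⟨?_, ?_, ?_, ?_, ?_, ?_, ?_, ?_, hspan⟩, ?_, ?_⟩
      · simp only [Op.code, List.length] at ht ht₁
        have : P.m * (2 * A + B + C + 10) = P.m * (2 * A + B + C + 9 + 1) := by ring
        omega
      · rw [hr _ (by decide), h7, hsP]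
      · rw [hr _ (by decide), h1]
      · rw [hr _ (by decide), h2]
      · rw [hf _ (by decide), ← hσ₂]
        simp [h1, h2, he, hl]
      · rw [hr _ (by decide), h6]
      · rw [hr _ (by decide), h3]
      · rw [hr _ (by decide), h4]
      · rw [hr _ (by decide), h5]
      · rw [hmem, ← hσ₂]; simpa using h9
      · rw [hr _ (by decide), h8]
    · rintro k τ - ⟨j, hj, hspan, hmem⟩ -
      simp [Op.code, hspan, hmem]
      exact ⟨j + 1, by omega, by ring⟩
    · exact ⟨0, by omega, by simp [← hσ₂, h1, h2, he, hl], rfl⟩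
  · rintro k τ - ⟨j, hj, h1, h2, h3, h4, h5, h6, h7, h8, h9, h10⟩
    simp [growCmd, Op.code, h1, h2, h3, h4, h5, h6, h7, h8, h9, h10]
    have e1 : 2 ^ B * 2 ^ (B * j) = 2 ^ (B * (j + 1)) := by ring
    have e2 : A * j + A = A * (j + 1) := by ring
    have e3 : 2 * 2 ^ j = 2 ^ (j + 1) := by ring
    have e4 : 2 ^ A * 2 ^ (A * j + 1) = 2 ^ (A * (j + 1) + 1) := by ring
    have e5 : 2 ^ (A + 1) * 2 ^ (A * j + j + 2) = 2 ^ (A * (j + 1) + (j + 1) + 2) := by ring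
    have e6 : 2 ^ C * 2 ^ (C * j) = 2 ^ (C * (j + 1)) := by ring
    rw [e1, e2, e3, e4, e5, e6]
    have hlogj := hlog j
    refine ⟨by omega, ?_⟩
    rcases k with _ | k
    · left
      have hjm : j + 1 = P.m := by omega
      rw [hjm] at hlogj ⊢
      refine ⟨by omega, rfl, he.symm, rfl, by rw [he], by rw [hl], hn.symm⟩
    · right
      exact ⟨by omega, k, rfl, by omega, rfl, rfl, rfl, rfl, rfl, rfl⟩
  · refine ⟨0, by omega, ?_⟩
    simp [← hσ', hs]

/-! ### The estimator -/

/-- The number whose binary digits form the string of length `s` that has probability one. -/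
noncomputable def target (A B C : ℕ) (hA : 0 < A) (s : ℕ) : ℕ :=
  if (sizes A B C hA s).l ≤ s then (sizes A B C hA s).choice else 0

theorem target_lt (A B C : ℕ) (hA : 0 < A) (s : ℕ) : target A B C hA s < 2 ^ s := by
  rw [target]
  split_ifs with h
  · exact (Sizes.choice_lt _).trans_le (Nat.pow_le_pow_right (by norm_num) h)
  · positivity

/-- A bound on the running time for inputs of length `s`. -/
def totalTime (A B C : ℕ) (hA : 0 < A) (s : ℕ) : ℕ :=
  12 * s + 200 + (sizes A B C hA s).m * (2 * A + B + C + 10) + 4 * (sizes A B C hA s).n +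
    (sizes A B C hA s).searchTime

theorem wp_compare {W Z l s : ℕ} {σ : State} (hs : σ.var .len = s) (hl : σ.var .ell = l)
    (hW : σ.var .word = W) (hZ : σ.var .cand = Z) :
    wp compareCmd σ 0 fun τ t => t ≤ 12 ∧
      τ.var .len = (if W = if l ≤ s then Z else 0 then 1 else 0) ∧ τ.var .word = 1 := by
  by_cases h : l ≤ s
  · have h1 : l - s = 0 := by omega
    simp [compareCmd, Op.code, hs, hl, hW, hZ, h1, h]
    split_ifs <;> omega
  · have h1 : 1 - (l - s) = 0 := by omega
    simp [compareCmd, Op.code, hs, hl, hW, h1, h]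
    split_ifs <;> omega

theorem wp_estimator {A B C s : ℕ} {hA : 0 < A} (hB : 0 < B) {f : ℕ → Bool} {σ : State}
    (hs : σ.var .len = s) (hpw : σ.var .pw = (f 0).toNat)
    (hvar : ∀ j (h : j < inputVars.length), σ.var inputVars[j] = (f (1 + j)).toNat)
    (hmem : ∀ a, σ.mem a = (f (29 + a)).toNat) (hf : ∀ i, s ≤ i → f i = false) :
    wp (estimatorCmd A B C) σ 0 fun τ t => t ≤ totalTime A B C hA s ∧
      τ.var .len = (if bitSum f (29 + (s + 1)) = target A B C hA s then 1 else 0) ∧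
      τ.var .word = 1 := by
  have hsP : (sizes A B C hA s).s = s := rfl
  rw [estimatorCmd, wp_seq]
  refine wp_frame (wp_mono (wp_read hs hpw hvar hmem) ?_)
  rintro σ₁ t₁ ⟨ht₁, hw₁, hm₁⟩ hf₁
  rw [wp_seq]
  refine wp_mono (wp_shift (wp_sizes (A := A) (B := B) (C := C) (s := s) (hA := hA) hB ?_) t₁) ?_
  · rw [hf₁ _ (by decide), hs]
  rintro σ₂ t₂ ⟨ht₂, hst₂, hm₂, hw₂⟩
  rw [wp_seq]
  refine wp_frame (wp_mono (wp_shift (Sizes.wp_search hst₂ ?_) t₂) ?_)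
  · intro a ha
    rw [hm₂, hm₁, hmem, hf _ (by omega)]
    rfl
  rintro σ₃ t₃ ⟨ht₃, hc₃⟩ hf₃
  refine wp_mono (wp_shift (wp_compare (W := bitSum f (29 + (s + 1))) (s := s)
    (l := (sizes A B C hA s).l) ?_ ?_ ?_ hc₃) t₃) ?_
  · rw [hf₃ _ (by decide), hst₂.len, hsP]
  · rw [hf₃ _ (by decide), hst₂.ell]
  · rw [hf₃ _ (by decide), hw₂, hw₁]
  rintro τ t ⟨ht, h0, h1⟩
  exact ⟨by rw [totalTime]; omega, h0, h1⟩

/-- The deterministic estimator: the string given by `target` has probability one. -/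
noncomputable def estimator (A B C : ℕ) (hA : 0 < A) (x : List Bool) : ℝ :=
  if x = bitString x.length (target A B C hA x.length) then 1 else 0

theorem bitSum_eq_iff {x : List Bool} {N Z : ℕ} (hN : x.length ≤ N) (hZ : Z < 2 ^ x.length) :
    bitSum (fun i => x.getD i false) N = Z ↔ x = bitString x.length Z := by
  constructor
  · rintro rfl
    refine List.ext_getElem (by simp [bitString]) fun i hi _ => ?_
    have h : i < N := by omega
    simp [bitString, testBit_bitSum, h]
  · intro h
    refine Nat.eq_of_testBit_eq fun i => ?_
    rw [testBit_bitSum]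
    by_cases hi : i < x.length
    · have h1 : i < N := by omega
      rw [List.getD_eq_getElem _ _ hi]
      have : x[i] = (bitString x.length Z)[i]'(by simpa [bitString] using hi) := by
        congr 1
      rw [this]
      simp [bitString, h1]
    · rw [Nat.testBit_lt_two_pow (hZ.trans_le (Nat.pow_le_pow_right (by norm_num) (by omega))),
        List.getD_eq_default _ _ (by omega)]
      simp

/-- The machine computes the estimator, with an error of zero. -/
theorem estimator_approximates (A B C : ℕ) (hA : 0 < A) (hB : 0 < B) (x : List Bool) {ε : ℚ}
    (hε : 0 < ε) :
    Approximates ((estimatorCmd A B C).code 0) x ε (totalTime A B C hA x.length)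
      (estimator A B C hA x) := by
  set p := (estimatorCmd A B C).code 0 with hp
  let σ : State := ⟨fun v => (initial x ε).reg v.idx, fun a => (initial x ε).reg (memStart + a)⟩
  obtain ⟨τ, t, he, ht, h0, h1⟩ := wp_estimator (A := A) (B := B) (C := C) (s := x.length)
    (hA := hA) hB (f := fun i => x.getD i false) (σ := σ) rfl rfl
    (by
      intro j hj
      show (initial x ε).reg inputVars[j].idx = _
      rw [show inputVars[j].idx = 1 + j + 3 from idx_inputVars ⟨j, hj⟩]
      rfl)
    (by
      intro a
      show (initial x ε).reg (32 + a) = _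
      rw [show 32 + a = 29 + a + 3 by ring]
      rfl)
    (fun i hi => List.getD_eq_default _ _ hi)
  obtain ⟨R, hR, hreach⟩ := he.correct (p := p) (l := 0) (R := (initial x ε).reg)
    (fun j _ => by rw [zero_add]) ⟨fun _ => rfl, fun _ => rfl⟩
  have hhalt : ∀ k, (step p)^[k] ⟨0 + p.length, R⟩ = ⟨0 + p.length, R⟩ := by
    intro k
    refine Function.iterate_fixed ?_ k
    simp [step]
  have hrun : (step p)^[totalTime A B C hA x.length] (initial x ε) = ⟨0 + p.length, R⟩ := by
    rw [zero_add] at ht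
    rw [← Nat.sub_add_cancel ht, Function.iterate_add_apply]
    exact (congrArg _ hreach).trans (hhalt _)
  have hR0 : R 0 = τ.var .len := hR.1 .len
  have hR1 : R 1 = τ.var .word := hR.1 .word
  have hval : ((R 0 : ℕ) : ℝ) / (R 1 : ℕ) = estimator A B C hA x := by
    rw [hR0, hR1, h0, h1, estimator]
    simp only [bitSum_eq_iff (N := 29 + (x.length + 1)) (by omega) (target_lt A B C hA x.length)]
    split_ifs <;> simp
  unfold Approximates Halted
  rw [hrun]
  refine ⟨by simp, ?_, ?_⟩
  · show 0 < R 1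
    rw [hR1, h1]; norm_num
  · show |((R 0 : ℕ) : ℝ) / (R 1 : ℕ) - _| ≤ _
    rw [hval, sub_self, abs_zero]
    have : 0 ≤ estimator A B C hA x := by rw [estimator]; split_ifs <;> norm_num
    positivity

/-! ### The running time -/

/-- The search dominates: there are `2 ^ l` strings and `2 ^ m` programs, each of them running for
`n` steps, where `l = A * m + m + 2` and `n = 2 ^ (C * m)`. -/
theorem totalTime_le (A B C : ℕ) (hA : 0 < A) (hC : 0 < C) : ∃ K : ℕ, ∀ s,
    totalTime A B C hA s ≤ 12 * s + 204 + K * 2 ^ ((A + 2 + C) * (Nat.log (2 ^ B) s + 1)) := by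
  refine ⟨2 * A + B + C + 14 + 4 * (19 + 15 * (A + 3) + 153 + 4 * A + 86), fun s => ?_⟩
  have hm : (sizes A B C hA s).m = Nat.log (2 ^ B) s + 1 := rfl
  have he : (sizes A B C hA s).e = A * (sizes A B C hA s).m := rfl
  have hl : (sizes A B C hA s).l = A * (sizes A B C hA s).m + (sizes A B C hA s).m + 2 := rfl
  have hn : (sizes A B C hA s).n = 2 ^ (C * (sizes A B C hA s).m) := rfl
  rw [totalTime, ← hm]
  have hm0 := (sizes A B C hA s).m_pos
  generalize sizes A B C hA s = P at *
  have hmn : P.m ≤ P.n := by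
    rw [hn]
    exact (Nat.lt_two_pow_self (n := P.m)).le.trans
      (Nat.pow_le_pow_right (by norm_num) (Nat.le_mul_of_pos_left _ hC))
  have hn1 : 1 ≤ P.n := by omega
  have hAm : A * P.m ≤ A * P.n := Nat.mul_le_mul_left _ hmn
  have hrt : P.runTime + 10 ≤ (19 + 15 * (A + 3) + 153 + 4 * A + 86) * P.n := by
    rw [Sizes.runTime, he, hl]
    nlinarith
  have hX : 2 ^ ((A + 2 + C) * P.m) = 2 ^ (A * P.m) * 2 ^ P.m * 2 ^ P.m * P.n := by
    rw [hn]; ring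
  have hX' : 2 ^ P.l * (2 ^ P.m * P.n) = 4 * 2 ^ ((A + 2 + C) * P.m) := by
    rw [hX, hl]; ring
  have hnX : P.n ≤ 2 ^ ((A + 2 + C) * P.m) := by
    rw [hX]; exact Nat.le_mul_of_pos_left _ (by positivity)
  have h1 : P.m * (2 * A + B + C + 10) ≤ (2 * A + B + C + 10) * 2 ^ ((A + 2 + C) * P.m) := by
    rw [mul_comm]; exact Nat.mul_le_mul_left _ (hmn.trans hnX)
  have h2 : P.searchTime ≤
      4 * (19 + 15 * (A + 3) + 153 + 4 * A + 86) * 2 ^ ((A + 2 + C) * P.m) + 4 := by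
    have h3 : 2 ^ P.m * (P.runTime + 3) + 7 ≤ 2 ^ P.m * (P.runTime + 10) := by
      have : 1 ≤ 2 ^ P.m := Nat.one_le_two_pow
      nlinarith
    have h4 := Nat.mul_le_mul_left (2 ^ P.l) (h3.trans (Nat.mul_le_mul_left (2 ^ P.m) hrt))
    rw [Sizes.searchTime]
    refine (Nat.add_le_add_right h4 4).trans (le_of_eq ?_)
    rw [mul_assoc 4, mul_left_comm 4, ← hX']; ring
  have h5 : 4 * P.n ≤ 4 * 2 ^ ((A + 2 + C) * P.m) := Nat.mul_le_mul_left _ hnX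
  calc _ ≤ 12 * s + 200 + (2 * A + B + C + 10) * 2 ^ ((A + 2 + C) * P.m) +
        4 * 2 ^ ((A + 2 + C) * P.m) +
        (4 * (19 + 15 * (A + 3) + 153 + 4 * A + 86) * 2 ^ ((A + 2 + C) * P.m) + 4) := by omega
    _ = _ := by ring

theorem totalTime_isBigO {A B C : ℕ} {hA : 0 < A} (hC : 0 < C) {g : ℝ} (hg : 1 ≤ g)
    (h : (A + 2 + C : ℝ) ≤ g * B) :
    (fun s => (totalTime A B C hA s : ℝ)) =O[atTop] fun s => (s : ℝ) ^ g := by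
  obtain ⟨K, hK⟩ := totalTime_le A B C hA hC
  refine IsBigO.of_bound (216 + K * 2 ^ (A + 2 + C)) ?_
  filter_upwards [eventually_ge_atTop 1] with s hs
  have hs1 : (1 : ℝ) ≤ s := by exact_mod_cast hs
  have h1 : (1 : ℝ) ≤ (s : ℝ) ^ g := Real.one_le_rpow hs1 (by linarith)
  have h2 : (s : ℝ) ≤ (s : ℝ) ^ g := Real.self_le_rpow_of_one_le hs1 hg
  have h3 : (2 : ℝ) ^ ((A + 2 + C) * Nat.log (2 ^ B) s) ≤ (s : ℝ) ^ g := by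
    have h4 : (2 : ℝ) ^ (B * Nat.log (2 ^ B) s) ≤ s := by
      rw [pow_mul]
      exact_mod_cast Nat.pow_log_le_self (2 ^ B) (by omega)
    calc (2 : ℝ) ^ ((A + 2 + C) * Nat.log (2 ^ B) s)
        = (2 : ℝ) ^ ((A + 2 + C : ℝ) * Nat.log (2 ^ B) s) := by
          rw [← Real.rpow_natCast]; push_cast; rfl
      _ ≤ (2 : ℝ) ^ (((B * Nat.log (2 ^ B) s : ℕ) : ℝ) * g) := by
          refine Real.rpow_le_rpow_of_exponent_le (by norm_num) ?_
          push_cast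
          have : (0 : ℝ) ≤ Nat.log (2 ^ B) s := Nat.cast_nonneg _
          nlinarith
      _ = ((2 : ℝ) ^ (B * Nat.log (2 ^ B) s)) ^ g := by
          rw [Real.rpow_mul (by norm_num), Real.rpow_natCast]
      _ ≤ _ := Real.rpow_le_rpow (by positivity) h4 (by linarith)
  have h5 : (totalTime A B C hA s : ℝ) ≤
      12 * s + 204 + K * 2 ^ ((A + 2 + C) * (Nat.log (2 ^ B) s + 1)) := by exact_mod_cast hK s
  have h6 : (2 : ℝ) ^ ((A + 2 + C) * (Nat.log (2 ^ B) s + 1)) ≤ 2 ^ (A + 2 + C) * (s : ℝ) ^ g := by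
    rw [mul_add, mul_one, pow_add, mul_comm]
    exact mul_le_mul_of_nonneg_left h3 (by positivity)
  have h7 := mul_le_mul_of_nonneg_left h6 (Nat.cast_nonneg (α := ℝ) K)
  rw [Real.norm_of_nonneg (by positivity), Real.norm_of_nonneg (by positivity)]
  nlinarith

/-! ### Online estimators on the strings of a given length -/

theorem bitString_succ_of_lt {l z : ℕ} (h : z < 2 ^ l) :
    bitString (l + 1) z = bitString l z ++ [false] := by
  rw [bitString, List.ofFn_succ_last]
  simp [bitString, Nat.testBit_lt_two_pow h]

theorem bitString_succ_add {l z : ℕ} (h : z < 2 ^ l) :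
    bitString (l + 1) (2 ^ l + z) = bitString l z ++ [true] := by
  rw [bitString, List.ofFn_succ_last]
  simp only [Fin.val_castSucc, Fin.val_last, Nat.testBit_two_pow_add_eq, Nat.testBit_lt_two_pow h,
    bitString]
  congr 2
  funext i
  exact Nat.testBit_two_pow_add_gt i.2 z

theorem take_bitString {l n z : ℕ} (h : l ≤ n) : (bitString n z).take l = bitString l z := by
  refine List.ext_getElem (by simp [bitString, h]) fun i _ _ => ?_
  simp [bitString]

theorem IsOnline.sum_bitString {q : List Bool → ℝ} (hq : IsOnline q) (l : ℕ) :
    ∑ z ∈ Finset.range (2 ^ l), q (bitString l z) = 1 := by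
  induction l with
  | zero => simpa [bitString] using hq.2.1
  | succ l ih =>
    rw [pow_succ, mul_two, Finset.sum_range_add, ← Finset.sum_add_distrib, ← ih]
    refine Finset.sum_congr rfl fun z hz => ?_
    have hz := Finset.mem_range.1 hz
    rw [bitString_succ_of_lt hz, bitString_succ_add hz, hq.2.2]

theorem IsOnline.append_le {q : List Bool → ℝ} (hq : IsOnline q) (x y : List Bool) :
    q (x ++ y) ≤ q x := by
  induction y generalizing x with
  | nil => simp
  | cons b y ih =>
    have h1 := ih (x ++ [b])
    rw [List.append_assoc, List.singleton_append] at h1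
    refine h1.trans ?_
    have h2 := hq.2.2 x
    have h3 := hq.1 (x ++ [false])
    have h4 := hq.1 (x ++ [true])
    cases b <;> linarith

theorem IsOnline.le_one {q : List Bool → ℝ} (hq : IsOnline q) (x : List Bool) : q x ≤ 1 := by
  have := hq.append_le [] x
  rwa [hq.2.1, List.nil_append] at this

/-! ### Admissible programs -/

theorem Approximates.mono {p : Program} {x : List Bool} {ε : ℚ} {t t' : ℕ} {v : ℝ}
    (h : Approximates p x ε t v) (ht : t ≤ t') : Approximates p x ε t' v := by
  have : (step p)^[t'] (initial x ε) = (step p)^[t] (initial x ε) := by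
    rw [← Nat.sub_add_cancel ht, Function.iterate_add_apply]
    refine Function.iterate_fixed ?_ _
    rw [step, List.getElem?_eq_none_iff.2 h.1]
  unfold Approximates
  rw [this]
  exact h

section
variable {P : Sizes} {p : Program} {q : List Bool → ℝ} {u : ℕ}

theorem Sizes.result_eq (hu : codeArray P.m u = progArray p) (z : ℕ) :
    P.result u z = (step p)^[P.n] (initial (bitString P.l z) (1 / 2)) := by
  rw [Sizes.result, hu, simStep_progArray]

/-- With the accuracy `1 / 2`, an output greater than `2 ^ (-e)` shows that `q` is at least half of
it. -/
theorem Sizes.le_of_bad (hu : codeArray P.m u = progArray p) {z : ℕ}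
    (h : Approximates p (bitString P.l z) (1 / 2) P.n (q (bitString P.l z))) (hb : P.Bad u z) :
    1 ≤ 2 ^ (P.e + 1) * q (bitString P.l z) := by
  obtain ⟨-, h0, h1⟩ := hb
  rw [Approximates, ← Sizes.result_eq hu] at h
  obtain ⟨-, -, h⟩ := h
  have h0' : (0 : ℝ) < (P.result u z).reg 1 := by exact_mod_cast h0
  have h1' : ((P.result u z).reg 1 : ℝ) < 2 ^ P.e * (P.result u z).reg 0 := by exact_mod_cast h1
  have h2 : 1 < 2 ^ P.e * (((P.result u z).reg 0 : ℝ) / (P.result u z).reg 1) := by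
    rw [← mul_div_assoc, lt_div_iff₀ h0', one_mul]; exact h1'
  have h3 := (abs_le.1 h).2
  push_cast at h3
  have h4 : ((P.result u z).reg 0 : ℝ) / (P.result u z).reg 1 ≤ 2 * q (bitString P.l z) := by
    have : 0 ≤ ((P.result u z).reg 0 : ℝ) / (P.result u z).reg 1 := by positivity
    linarith
  have h5 := mul_le_mul_of_nonneg_left h4 (by positivity : (0 : ℝ) ≤ 2 ^ P.e)
  rw [pow_succ, mul_assoc]
  linarith

theorem Sizes.le_of_not_bad (hu : codeArray P.m u = progArray p) {z : ℕ}
    (h : Approximates p (bitString P.l z) (1 / 2) P.n (q (bitString P.l z))) (hb : ¬ P.Bad u z) :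
    2 ^ P.e * q (bitString P.l z) ≤ 2 := by
  rw [Approximates, ← Sizes.result_eq hu] at h
  obtain ⟨hh, h0, h⟩ := h
  have h1 : 2 ^ P.e * (P.result u z).reg 0 ≤ (P.result u z).reg 1 := by
    by_contra! h1
    exact hb ⟨by rw [hu]; exact (progArray_eq_zero_iff _ _).2 hh, h0, h1⟩
  have h0' : (0 : ℝ) < (P.result u z).reg 1 := by exact_mod_cast h0
  have h1' : 2 ^ P.e * ((P.result u z).reg 0 : ℝ) ≤ (P.result u z).reg 1 := by exact_mod_cast h1
  have h2 : 2 ^ P.e * (((P.result u z).reg 0 : ℝ) / (P.result u z).reg 1) ≤ 1 := by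
    rw [← mul_div_assoc, div_le_iff₀ h0', one_mul]; exact h1'
  have h3 := (abs_le.1 h).1
  push_cast at h3
  have h4 : q (bitString P.l z) ≤ 2 * (((P.result u z).reg 0 : ℝ) / (P.result u z).reg 1) := by
    linarith
  have h5 := mul_le_mul_of_nonneg_left h4 (by positivity : (0 : ℝ) ≤ 2 ^ P.e)
  linarith

/-- On the chosen string, every online estimator that is computed in time by one of the first
programs is small: since its values add up to `1`, it has few bad strings. -/
theorem Sizes.choice_le (hu : codeArray P.m u = progArray p) (hum : u < 2 ^ P.m) (hq : IsOnline q)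
    (h : ∀ z, Approximates p (bitString P.l z) (1 / 2) P.n (q (bitString P.l z))) :
    2 ^ P.e * q (bitString P.l P.choice) ≤ 2 := by
  classical
  refine Sizes.le_of_not_bad hu (h _) (not_bad_of_not_excluded (N := 2 ^ P.l) hum ?_ P.choice_lt
    P.choice_not_out)
  have h1 : (((Finset.range (2 ^ P.l)).filter (P.Bad u)).card : ℝ) ≤ 2 ^ (P.e + 1) := by
    calc (((Finset.range (2 ^ P.l)).filter (P.Bad u)).card : ℝ)
        = ∑ z ∈ (Finset.range (2 ^ P.l)).filter (P.Bad u), 1 := by simp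
      _ ≤ ∑ z ∈ (Finset.range (2 ^ P.l)).filter (P.Bad u), 2 ^ (P.e + 1) * q (bitString P.l z) :=
          Finset.sum_le_sum fun z hz => Sizes.le_of_bad hu (h z) (Finset.mem_filter.1 hz).2
      _ ≤ ∑ z ∈ Finset.range (2 ^ P.l), 2 ^ (P.e + 1) * q (bitString P.l z) :=
          Finset.sum_le_sum_of_subset_of_nonneg (Finset.filter_subset _ _) fun z _ _ =>
            mul_nonneg (by positivity) (hq.1 _)
      _ = 2 ^ (P.e + 1) := by rw [← Finset.mul_sum, hq.sum_bitString, mul_one]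
  exact_mod_cast h1

end

/-! ### The regret of the estimator -/

theorem estimator_isOffline (A B C : ℕ) (hA : 0 < A) : IsOffline (estimator A B C hA) := by
  refine ⟨fun x => by rw [estimator]; split_ifs <;> norm_num, fun s => ?_⟩
  simp [estimator, bitString, List.ofFn_inj]

theorem estimator_isDeterministic (A B C : ℕ) (hA : 0 < A) :
    IsDeterministic (estimator A B C hA) := by
  intro x
  rw [estimator]
  split_ifs <;> simp

/-- A string of probability one whose online probability is at most `n ^ (-r)` forces the regret. -/
theorem le_regret {qt q : List Bool → ℝ} {n : ℕ} (x : Fin n → Bool) (hq : q (List.ofFn x) = 1)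
    {r : ℝ} (hn : 0 < n) (h : (n : ℝ) ^ r * qt (List.ofFn x) ≤ 1) :
    ((r * Real.log n : ℝ) : EReal) ≤ regret qt q n := by
  have hn' : (0 : ℝ) < n := by exact_mod_cast hn
  refine le_trans ?_ (le_iSup _ x)
  rw [← Real.log_rpow hn', ← ENNReal.log_ofReal_of_pos (by positivity), ENNReal.log_le_log_iff, hq,
    ENNReal.ofReal_one, one_div, ENNReal.le_inv_iff_mul_le, ← ENNReal.ofReal_mul (by positivity)]
  exact ENNReal.ofReal_le_one.2 h

theorem tendsto_log_add_one {B : ℕ} (hB : 0 < B) :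
    Tendsto (fun n => Nat.log (2 ^ B) n + 1) atTop atTop := by
  refine tendsto_atTop.2 fun k => ?_
  filter_upwards [eventually_ge_atTop ((2 ^ B) ^ k)] with n hn
  have : k ≤ Nat.log (2 ^ B) n :=
    Nat.le_log_of_pow_le (Nat.one_lt_two_pow (by omega)) hn
  omega

/-- Programs for `E^c` may take time `2 ^ (c * l)` on the candidate strings, whose length `l` is
about `(A + 1) * m`; so they halt within `2 ^ (C * m)` steps, for all large `m`. -/
theorem estimator_regret {A B C : ℕ} {hA : 0 < A} (hB : 0 < B) {r c : ℝ} (hr : 0 < r)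
    (hrA : r * B + 1 ≤ A) (hcC : c * (A + 1) < C) {qt : List Bool → ℝ} (hqt : IsOnline qt)
    (hE : InE c qt) :
    ∀ᶠ n : ℕ in atTop, ((r * Real.log n : ℝ) : EReal) ≤ regret qt (estimator A B C hA) n := by
  obtain ⟨p, hp⟩ := hE
  obtain ⟨T, hT, hp⟩ := hp (1 / 2) (by norm_num)
  obtain ⟨N, hN⟩ := exists_codeArray p
  obtain ⟨K, hK0, hK⟩ := hT.exists_pos
  rw [isBigOWith_iff] at hK
  -- the length of the candidate strings, as a function of the number of bits of a program
  have hl : Tendsto (fun m : ℕ => A * m + m + 2) atTop atTop :=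
    tendsto_atTop_mono (fun m => by show m ≤ _; omega) tendsto_id
  -- the online estimator is computed in time on the candidate strings
  have hclock : ∀ᶠ m : ℕ in atTop, T (A * m + m + 2) ≤ 2 ^ (C * m) := by
    have hδ : 0 < C - c * (A + 1) := by linarith
    have h1 : ∀ᶠ m : ℕ in atTop, K * 2 ^ (2 * c) ≤ (2 : ℝ) ^ ((C - c * (A + 1)) * m) := by
      have h2 : Tendsto (fun m : ℕ => ((2 : ℝ) ^ (C - c * (A + 1))) ^ m) atTop atTop :=
        tendsto_pow_atTop_atTop_of_one_lt (Real.one_lt_rpow (by norm_num) hδ)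
      filter_upwards [h2.eventually_ge_atTop (K * 2 ^ (2 * c))] with m hm
      rwa [Real.rpow_mul (by norm_num) (C - c * (A + 1) : ℝ), Real.rpow_natCast]
    filter_upwards [hl.eventually hK, h1] with m hm hm1
    rw [Real.norm_of_nonneg (by positivity), Real.norm_of_nonneg (by positivity)] at hm
    have h3 : K * (2 : ℝ) ^ (c * ((A * m + m + 2 : ℕ) : ℝ)) ≤ 2 ^ (C * m) := by
      have e1 : c * ((A * m + m + 2 : ℕ) : ℝ) = 2 * c + c * (A + 1) * m := by push_cast; ring
      rw [e1, Real.rpow_add (by norm_num), ← mul_assoc]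
      refine (mul_le_mul_of_nonneg_right hm1 (by positivity)).trans (le_of_eq ?_)
      rw [← Real.rpow_add (by norm_num), ← Real.rpow_natCast]
      congr 1; push_cast; ring
    exact_mod_cast hm.trans h3
  -- the candidate strings are not longer than the input
  have hlen : ∀ᶠ m : ℕ in atTop, A * m + m + 2 ≤ 2 ^ (m - 1) := by
    have h1 := (isLittleO_pow_const_const_pow_of_one_lt (R := ℝ) 1 one_lt_two).def
      (by positivity : (0 : ℝ) < 1 / (2 * (A + 4)))
    filter_upwards [h1, eventually_ge_atTop 1] with m hm hm1
    obtain ⟨m, rfl⟩ : ∃ m', m = m' + 1 := ⟨m - 1, by omega⟩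
    rw [Real.norm_of_nonneg (by positivity), Real.norm_of_nonneg (by positivity), pow_one,
      one_div, inv_mul_eq_div, le_div_iff₀ (by positivity), pow_succ] at hm
    push_cast at hm
    have : (A * (m + 1) + (m + 1) + 2 : ℝ) ≤ 2 ^ m := by
      have : (0 : ℝ) ≤ m := Nat.cast_nonneg m
      nlinarith
    simp only [Nat.add_sub_cancel]
    exact_mod_cast this
  filter_upwards [(tendsto_log_add_one hB).eventually hclock,
    (tendsto_log_add_one hB).eventually hlen,
    (tendsto_log_add_one hB).eventually (eventually_ge_atTop N), eventually_ge_atTop 1]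
    with n h1 h2 h3 hn
  obtain ⟨u, hu, hcode⟩ := hN _ h3
  have hln : (sizes A B C hA n).l ≤ n := by
    refine h2.trans (le_trans ?_ (Nat.pow_log_le_self (2 ^ B) (by omega : n ≠ 0)))
    rw [← pow_mul]
    exact Nat.pow_le_pow_right (by norm_num) (Nat.le_mul_of_pos_left _ hB)
  have key := Sizes.choice_le (P := sizes A B C hA n) hcode hu hqt fun z =>
    (hp (bitString (sizes A B C hA n).l z)).mono (by rw [bitString, List.length_ofFn]; exact h1)
  have htarget : target A B C hA n = (sizes A B C hA n).choice := by rw [target, if_pos hln]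
  refine le_regret (fun i : Fin n => (target A B C hA n).testBit i) ?_ (by omega) ?_
  · rw [estimator, List.length_ofFn, bitString, if_pos rfl]
  change (n : ℝ) ^ r * qt (bitString n (target A B C hA n)) ≤ 1
  -- the target extends the chosen string, and online estimators decrease along extensions
  have hmono : qt (bitString n (target A B C hA n)) ≤
      qt (bitString (sizes A B C hA n).l (sizes A B C hA n).choice) := by
    rw [htarget, ← take_bitString hln]
    conv_lhs => rw [← List.take_append_drop (sizes A B C hA n).l (bitString n _)]
    exact hqt.append_le _ _
  -- the threshold: `n < 2 ^ (B * m)`, and `r * B * m + 1 ≤ A * m = e`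
  have hpow : 2 * (n : ℝ) ^ r ≤ 2 ^ (sizes A B C hA n).e := by
    have h4 : (n : ℝ) ≤ 2 ^ (B * (Nat.log (2 ^ B) n + 1)) := by
      rw [pow_mul]
      exact_mod_cast (Nat.lt_pow_succ_log_self (Nat.one_lt_two_pow (by omega)) n).le
    have h5 := Real.rpow_le_rpow (by positivity) h4 hr.le
    rw [← Real.rpow_natCast, ← Real.rpow_mul (by norm_num)] at h5
    refine (mul_le_mul_of_nonneg_left h5 (by norm_num)).trans ?_
    rw [← Real.rpow_natCast 2 (sizes A B C hA n).e]
    nth_rw 1 [← Real.rpow_one (2 : ℝ)]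
    rw [← Real.rpow_add (by norm_num)]
    refine Real.rpow_le_rpow_of_exponent_le (by norm_num) ?_
    change _ ≤ ((A * (Nat.log (2 ^ B) n + 1) : ℕ) : ℝ)
    push_cast
    have : (0 : ℝ) ≤ Nat.log (2 ^ B) n := Nat.cast_nonneg _
    nlinarith
  have h6 := hqt.1 (bitString (sizes A B C hA n).l (sizes A B C hA n).choice)
  have h7 : (0 : ℝ) ≤ (n : ℝ) ^ r := by positivity
  nlinarith [mul_le_mul_of_nonneg_left hmono h7, mul_le_mul_of_nonneg_right hpow h6]

/-- For every exponent greater than `r + r * c` there is an estimator that is computable in time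
`s ^ g` and forces the regret `r * log n` upon all online estimators in `E^c`. With `A` and `C`
the least possible, `A / B` tends to `r` and `C / B` to `r * c` for large `B`. -/
theorem exists_estimator {r c g : ℝ} (hr : 0 < r) (hc : 0 < c) (hg : 1 ≤ g) (h : r + r * c < g) :
    ∃ q : List Bool → ℝ, IsOffline q ∧ IsDeterministic q ∧ InUniformDTIME (fun s => (s : ℝ) ^ g) q ∧
      ∀ qt : List Bool → ℝ, IsOnline qt → InE c qt →
        ∀ᶠ n : ℕ in atTop, ((r * Real.log n : ℝ) : EReal) ≤ regret qt q n := by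
  obtain ⟨B, hB⟩ := exists_nat_ge ((5 + 3 * c) / (g - (r + r * c)))
  rw [div_le_iff₀ (by linarith)] at hB
  have hB0 : 0 < B := by
    rcases Nat.eq_zero_or_pos B with rfl | h
    · push_cast at hB; linarith
    · exact h
  have hrB : 0 ≤ r * B := by positivity
  have hA1 := Nat.le_ceil (r * B)
  have hA2 := Nat.ceil_lt_add_one hrB
  set A := ⌈r * B⌉₊ + 1 with hAdef
  have hA1' : r * B + 1 ≤ A := by rw [hAdef]; push_cast; linarith
  have hA2' : (A : ℝ) ≤ r * B + 2 := by rw [hAdef]; push_cast; linarith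
  have hA : 0 < A := by omega
  have hC1 := Nat.lt_floor_add_one (c * (A + 1 : ℝ))
  have hC2 := Nat.floor_le (a := c * (A + 1 : ℝ)) (by positivity)
  set C := ⌊c * (A + 1 : ℝ)⌋₊ + 1 with hCdef
  have hC1' : c * (A + 1) < C := by rw [hCdef]; push_cast; linarith
  have hC2' : (C : ℝ) ≤ c * (A + 1) + 1 := by rw [hCdef]; push_cast; linarith
  refine ⟨estimator A B C hA, estimator_isOffline A B C hA, estimator_isDeterministic A B C hA,
    ⟨(estimatorCmd A B C).code 0, totalTime A B C hA, totalTime_isBigO (by omega) hg ?_,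
      fun ε hε x => estimator_approximates A B C hA hB0 x hε⟩,
    fun qt hqt hE => estimator_regret hB0 hr hA1' hC1' hqt hE⟩
  nlinarith [mul_le_mul_of_nonneg_left hA2' hc.le]

theorem InP.inE {q : List Bool → ℝ} (h : InP q) {c : ℝ} (hc : 0 < c) : InE c q := by
  obtain ⟨k, p, hp⟩ := h
  refine ⟨p, fun ε hε => ?_⟩
  obtain ⟨T, hT, h⟩ := hp ε hε
  refine ⟨T, hT.trans ?_, h⟩
  have h1 := (isLittleO_pow_const_const_pow_of_one_lt (R := ℝ) k
    (Real.one_lt_rpow (by norm_num : (1 : ℝ) < 2) hc)).isBigO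
  refine h1.congr_right fun n => ?_
  rw [Real.rpow_mul (by norm_num), Real.rpow_natCast]

/-! ### The mixture -/

/-- The total probability of the continuations of `x` by `k` symbols. -/
def marginal (q : List Bool → ℝ) (x : List Bool) (k : ℕ) : ℝ :=
  ∑ y : Fin k → Bool, q (x ++ List.ofFn y)

theorem marginal_zero (q : List Bool → ℝ) (x : List Bool) : marginal q x 0 = q x := by
  simp [marginal]

theorem marginal_succ (q : List Bool → ℝ) (x : List Bool) (k : ℕ) :
    marginal q x (k + 1) = marginal q (x ++ [false]) k + marginal q (x ++ [true]) k := by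
  simp only [marginal]
  rw [← (Fin.consEquiv fun _ => Bool).sum_comp, Fintype.sum_prod_type, Fintype.sum_bool, add_comm]
  simp [Fin.consEquiv]

theorem condProb_append (Q : List Bool → Bool → ℝ) (y z : List Bool) (b : Bool) :
    condProb Q y (z ++ [b]) = condProb Q y z * Q (y ++ z) b := by
  induction z generalizing y with
  | nil => simp [condProb]
  | cons a z ih => simp [condProb, ih, mul_assoc]

theorem condProb_nonneg {Q : List Bool → Bool → ℝ} (hQ : IsPredictor Q) (y z : List Bool) :
    0 ≤ condProb Q y z := by
  induction z generalizing y with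
  | nil => simp [condProb]
  | cons a z ih => exact mul_nonneg (hQ.1 _ _) (ih _)

theorem extension_of_le {q : List Bool → ℝ} {Q : List Bool → Bool → ℝ} {s : ℕ} {x : List Bool}
    (h : x.length ≤ s) : extension q Q s x = marginal q x (s - x.length) := by
  rw [extension, if_pos h, marginal]

theorem extension_of_ge {q : List Bool → ℝ} {Q : List Bool → Bool → ℝ} {s : ℕ} {x : List Bool}
    (h : s ≤ x.length) : extension q Q s x = q (x.take s) * condProb Q (x.take s) (x.drop s) := by
  rw [extension]
  split_ifs with h'
  · obtain rfl : s = x.length := by omega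
    rw [← marginal, Nat.sub_self, marginal_zero]
    simp [condProb]
  · rfl

theorem extension_isOnline {q : List Bool → ℝ} {Q : List Bool → Bool → ℝ} (hq : IsOffline q)
    (hQ : IsPredictor Q) (s : ℕ) : IsOnline (extension q Q s) := by
  refine ⟨fun x => ?_, ?_, fun x => ?_⟩
  · rw [extension]
    split_ifs
    · exact Finset.sum_nonneg fun y _ => hq.1 _
    · exact mul_nonneg (hq.1 _) (condProb_nonneg hQ _ _)
  · rw [extension_of_le (Nat.zero_le _)]
    exact hq.2 s
  · rcases lt_or_ge x.length s with h | h
    · rw [extension_of_le (by simpa using h), extension_of_le (by simpa using h),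
        extension_of_le h.le, List.length_append, List.length_append,
        show s - x.length = s - (x.length + 1) + 1 by omega, marginal_succ]
      rfl
    · rw [extension_of_ge (by simp; omega), extension_of_ge (by simp; omega), extension_of_ge h]
      simp only [List.take_append_of_le_length h, List.drop_append_of_le_length h, condProb_append,
        List.take_append_drop]
      rw [← mul_add, ← mul_add, hQ.2, mul_one]

theorem extension_self {q : List Bool → ℝ} {Q : List Bool → Bool → ℝ} (x : List Bool) :
    extension q Q x.length x = q x := by
  rw [extension_of_le le_rfl, Nat.sub_self, marginal_zero]

/-- The prior is a probability. -/
theorem hasSum_prior : HasSum (fun s : ℕ => 1 / (((s : ℝ) + 1) * ((s : ℝ) + 2))) 1 := by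
  rw [hasSum_iff_tendsto_nat_of_nonneg (fun s => by positivity)]
  have h : ∀ n : ℕ, ∑ s ∈ Finset.range n, 1 / (((s : ℝ) + 1) * ((s : ℝ) + 2)) =
      1 - 1 / ((n : ℝ) + 1) := by
    intro n
    induction n with
    | zero => simp
    | succ n ih =>
      rw [Finset.sum_range_succ, ih]
      push_cast
      field_simp
      ring
  simp only [h]
  simpa using tendsto_one_div_add_atTop_nhds_zero_nat.const_sub (1 : ℝ)

section
variable {q : List Bool → ℝ} {Q : List Bool → Bool → ℝ}

theorem summable_mixture (hq : IsOffline q) (hQ : IsPredictor Q) (x : List Bool) :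
    Summable fun s : ℕ => extension q Q s x * (1 / (((s : ℝ) + 1) * ((s : ℝ) + 2))) :=
  hasSum_prior.summable.of_nonneg_of_le
    (fun s => mul_nonneg ((extension_isOnline hq hQ s).1 x) (by positivity))
    fun s => mul_le_of_le_one_left (by positivity) ((extension_isOnline hq hQ s).le_one x)

theorem mixture_isOnline (hq : IsOffline q) (hQ : IsPredictor Q) : IsOnline (mixture q Q) := by
  refine ⟨fun x => tsum_nonneg fun s => mul_nonneg ((extension_isOnline hq hQ s).1 x)
    (by positivity), ?_, fun x => ?_⟩
  · rw [mixture]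
    refine (tsum_congr fun s => ?_).trans hasSum_prior.tsum_eq
    rw [(extension_isOnline hq hQ s).2.1, one_mul]
  · rw [mixture, mixture, mixture,
      ← (summable_mixture hq hQ _).tsum_add (summable_mixture hq hQ _)]
    exact tsum_congr fun s => by rw [← add_mul, (extension_isOnline hq hQ s).2.2]

/-- The mixture dominates `q` up to the weight of the prior. -/
theorem le_mixture (hq : IsOffline q) (hQ : IsPredictor Q) (x : List Bool) :
    q x ≤ ((x.length : ℝ) + 1) * ((x.length : ℝ) + 2) * mixture q Q x := by
  have h := (summable_mixture hq hQ x).le_tsum x.length fun s _ =>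
    mul_nonneg ((extension_isOnline hq hQ s).1 x) (by positivity)
  rw [extension_self, mul_one_div, div_le_iff₀ (by positivity), mul_comm] at h
  exact h

theorem regret_mixture_le (hq : IsOffline q) (hQ : IsPredictor Q) (n : ℕ) :
    regret (mixture q Q) q n ≤ ENNReal.log (ENNReal.ofReal (((n : ℝ) + 1) * ((n : ℝ) + 2))) := by
  refine iSup_le fun x => ENNReal.log_le_log (ENNReal.div_le_of_le_mul ?_)
  rw [← ENNReal.ofReal_mul (by positivity)]
  refine ENNReal.ofReal_le_ofReal ?_
  simpa using le_mixture hq hQ (List.ofFn x)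

end

/-- The mixture is an online estimator with a regret of about `2 * log n`, which the estimator for
`r = 3` does not allow within `E^c`. -/
theorem exists_mixture_not_inE {c : ℝ} (hc : 0 < c) :
    ∃ q : List Bool → ℝ, IsOffline q ∧ IsDeterministic q ∧ InUniformP q ∧
      ∀ Q : List Bool → Bool → ℝ, IsPredictor Q → ¬ InE c (mixture q Q) := by
  obtain ⟨k, hk⟩ := exists_nat_gt (3 + 3 * c)
  obtain ⟨q, hq, hdet, hP, h⟩ := exists_estimator (g := k) (by norm_num : (0 : ℝ) < 3) hc
    (by linarith) hk
  refine ⟨q, hq, hdet, ⟨k, by simpa using hP⟩, fun Q hQ hE => ?_⟩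
  obtain ⟨n, hn, h4⟩ := ((h _ (mixture_isOnline hq hQ) hE).and (eventually_ge_atTop 4)).exists
  have h4' : (4 : ℝ) ≤ n := by exact_mod_cast h4
  have h1 := hn.trans (regret_mixture_le hq hQ n)
  rw [ENNReal.log_ofReal_of_pos (by positivity), EReal.coe_le_coe_iff,
    ← Real.log_rpow (by linarith), Real.log_le_log_iff (by positivity) (by positivity)] at h1
  norm_cast at h1
  -- `n ^ 3 ≤ (n + 1) * (n + 2)` fails for `n ≥ 4`
  nlinarith [mul_le_mul h4 h4 (by norm_num) (by omega), Nat.mul_le_mul_left (n * n) h4]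

end OfflineOnline

open OfflineOnline in
theorem theorem4 (r c ε : ℝ) (hr : 0 < r) (hc : 0 < c) (hε : 0 < ε) :
    -- (i), with machine constant `m = 1`
    (ε < 1 →
      ∃ q : List Bool → ℝ, IsOffline q ∧ IsDeterministic q ∧
        InUniformDTIME (fun s => (s : ℝ) ^ ((c + 1 + ε) / (1 - ε) * r + 1)) q ∧
        ∀ qt : List Bool → ℝ, IsOnline qt → InE c qt →
          ∀ᶠ n : ℕ in Filter.atTop, ((r * Real.log n : ℝ) : EReal) ≤ regret qt q n) ∧
    -- (ii)
    (∃ q : List Bool → ℝ, IsOffline q ∧ IsDeterministic q ∧ InUniformP q ∧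
        ∀ qt : List Bool → ℝ, IsOnline qt → InE c qt →
          ∀ᶠ n : ℕ in Filter.atTop, ((r * Real.log n : ℝ) : EReal) ≤ regret qt q n) ∧
    -- (iii), with machine constant `m = 1`
    (∃ q : List Bool → ℝ, IsOffline q ∧ IsDeterministic q ∧
        InUniformDTIME (fun s => (s : ℝ) ^ (r + 1 + ε)) q ∧
        ∀ qt : List Bool → ℝ, IsOnline qt → InP qt →
          ∀ᶠ n : ℕ in Filter.atTop, ((r * Real.log n : ℝ) : EReal) ≤ regret qt q n) ∧
    -- (iv)
    (∃ q : List Bool → ℝ, IsOffline q ∧ IsDeterministic q ∧ InUniformP q ∧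
        ∀ Q : List Bool → Bool → ℝ, IsPredictor Q → ¬ InE c (mixture q Q)) := by
  refine ⟨fun hε1 => ?_, ?_, ?_, exists_mixture_not_inE hc⟩
  -- the exponent of the first part is at least `(c + 1) * r + 1`
  · have h1 : (c + 1) * r ≤ (c + 1 + ε) / (1 - ε) * r := by
      refine mul_le_mul_of_nonneg_right ?_ hr.le
      rw [le_div_iff₀ (by linarith)]
      nlinarith
    have h2 : 0 < (c + 1) * r := by positivity
    exact exists_estimator hr hc (by linarith) (by linarith)
  · obtain ⟨k, hk⟩ := exists_nat_gt (max 1 (r + r * c))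
    obtain ⟨q, hq, hdet, hP, h⟩ := exists_estimator (g := k) hr hc
      ((le_max_left _ _).trans hk.le) ((le_max_right _ _).trans_lt hk)
    exact ⟨q, hq, hdet, ⟨k, by simpa using hP⟩, h⟩
  -- online estimators in `P` lie in `E^(1 / r)`, and `r + r * (1 / r) = r + 1`
  · obtain ⟨q, hq, hdet, hT, h⟩ := exists_estimator (c := 1 / r) (g := r + 1 + ε) hr (by positivity)
      (by linarith) (by rw [mul_one_div_cancel hr.ne']; linarith)
    exact ⟨q, hq, hdet, hT, fun qt hqt hP => h qt hqt (hP.inE (by positivity))⟩
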